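/- Let $m,N\ge 1$ be integers and $\kappa\in\mathbb C$. Let $\widehat{\mathfrak{gl}}_m=\mathfrak{gl}_m[t,t^{-1}]\oplus\mathbb C\,C$ be the affine Lie algebra with $C$ central and $$[A\,t^i,B\,t^j]=[A,B]\,t^{i+j}+i\,\delta_{i,-j}\,\mathrm{tr}(AB)\,C ,$$ and let $\widehat{\mathfrak{sl}}_m=\mathfrak{sl}_m[t,t^{-1}]\oplus\mathbb C\,C\subset\widehat{\mathfrak{gl}}_m$. Put $\mathfrak q=t^{-1}\mathfrak{sl}_m[t^{-1}]$. A module has level $\ell\in\mathbb C$ if $C$ acts on it as $\ell$. Write $E_{ab}$ for the matrix units and $I$ for the identity matrix. The trigonometric Cherednik algebra $\mathfrak T_N$ with parameter $\kappa$ is the complex associative algebra generated by the group algebra $\mathbb C\mathfrak S_N$, the ring $\mathbb C[x_1^{\pm1},\dots,x_N^{\pm1}]$ and pairwise commuting elements $u_1,\dots,u_N$, subject to the relations (with $\sigma_{pq}$ the transposition of $p,q$, with $\sigma_p=\sigma_{p,p+1}$ and $z_p=u_p-\sigma_{1p}-\dots-\sigma_{p-1,p}$) $$\sigma_p u_q=u_q\sigma_p\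 (q\ne p,p+1),\qquad \sigma_p u_p=u_{p+1}\sigma_p-1,\qquad \sigma x_p\sigma^{-1}=x_{\sigma(p)}\ (\sigma\in\mathfrak S_N),$$ $$[z_p,x_q]=-x_p\sigma_{pq}\ (q\neq p),\qquad [z_p,x_p]=\kappa x_p+\sum_{r\ne p}x_p\sigma_{pr}.$$ Let $V$ be an $\widehat{\mathfrak{sl}}_m$-module such that every vector of $V$ is annihilated by $t^i\,\mathfrak{sl}_m[t]$ for some degree $i$ (depending on the vector), and let $$W=\mathbb C[x_1^{\pm1},\dots,x_N^{\pm1}]\otimes(\mathbb C^m)^{\otimes N}\otimes V .$$ Let $A^{(p)}$ denote the matrix $A$ acting in the $p$-th factor of $(\mathbb C^m)^{\otimes N}$. The Lie algebra $\widehat{\mathfrak{sl}}_m$ acts on $W$ so that $A\,t^j$ acts as $\sum_{q=1}^N x_q^j\otimes A^{(q)}\otimes\mathrm{id}+\mathrm{id}\otimes\mathrm{id}\otimes A\,t^j$ and $C$ acts as $\mathrm{id}\otimes\mathrm{id}\otimes C$. For $p=1,\dots,N$ let $Z_p$ be the operator on $W$ $$\kappa\,x_p\partial_p\otimes\mathrm{id}\otimes\mathrm{id}+\sum_{r\ne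 p}\frac{x_p}{x_p-x_r}(1-\sigma_{pr})\otimes\sigma_{pr}\otimes\mathrm{id}+\sum_{i=0}^\infty x_p^{-i}\otimes\Bigl(\sum_{a,b=1}^m E_{ab}^{(p)}\otimes E_{ba}t^i-\frac1m\,\mathrm{id}\otimes I\,t^i\Bigr).$$ The expression in brackets uses only the $\widehat{\mathfrak{sl}}_m$-module structure of $V$, because $\sum_{a,b}E_{ab}\otimes E_{ba}-\frac1m I\otimes I\in\mathfrak{sl}_m\otimes\mathfrak{sl}_m$; on every vector of $W$ only finitely many terms of the sum over $i$ are non-zero. (i) There is a unique action of the algebra $\mathfrak T_N$ on $W$ such that $x_p,x_p^{-1}$ act by multiplication in $\mathbb C[x_1^{\pm1},\dots,x_N^{\pm1}]$, the group $\mathfrak S_N$ acts by simultaneous permutations of the variables $x_1,\dots,x_N$ and of the $N$ tensor factors $\mathbb C^m$, and $z_p$ acts as $Z_p$ for $p=1,\dots,N$. (ii) This action of $\mathfrak T_N$ commutes with the action of the Lie subalgebra $\mathfrak{sl}_m\subset\widehat{\mathfrak{sl}}_m$ on $W$. (iii) If $V$ has level $\kappa-m$, then the action of $\mathfrak T_N$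 preserves the subspace $\mathfrak q\,W\subset W$. Moreover, $V\mapsto W$ is functorial: if $f:V\to V'$ is a homomorphism of $\widehat{\mathfrak{sl}}_m$-modules, where $V'$ satisfies the same annihilation condition and $W'$ is the corresponding space, then $\mathrm{id}\otimes\mathrm{id}\otimes f:W\to W'$ commutes with the actions of $\mathfrak T_N$ and of $\widehat{\mathfrak{sl}}_m$. -/

import Mathlib

open scoped TensorProduct

attribute [local instance 100] LieRing.ofAssociativeRing

noncomputable section

namespace AffineCherednik

/-! ### The affine Lie algebras -/

/-- The complex general linear Lie algebra `gl_m` of `m × m` matrices. -/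
abbrev gl (m : ℕ) : Type := Matrix (Fin m) (Fin m) ℂ

/-- The complex special linear Lie algebra `sl_m` of traceless matrices. -/
abbrev sl (m : ℕ) : LieSubalgebra ℂ (gl m) := LieAlgebra.SpecialLinear.sl (Fin m) ℂ

/-- The current Lie algebra `gl_m[t, t⁻¹]`, with pointwise commutators. -/
abbrev Current (m : ℕ) : Type := LieAlgebra.loopAlgebra ℂ ℤ (gl m)

/-- The form `(A, B) ↦ -tr (A B)`. The sign is there because the cocycle that Mathlib attaches to a
form `Φ` sends `(A t^i, B t^j)` to `j Φ(A, B)` for `i + j = 0`. -/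
def negTrace (m : ℕ) : LinearMap.BilinForm ℂ (gl m) :=
  -((LinearMap.mul ℂ (gl m)).compr₂ (Matrix.traceLinearMap (Fin m) ℂ ℂ))

theorem negTrace_apply (m : ℕ) (A B : gl m) : negTrace m A B = -(A * B).trace := rfl

theorem negTrace_symm (m : ℕ) : (negTrace m).IsSymm :=
  ⟨fun A B => by simp [negTrace_apply, Matrix.trace_mul_comm A B]⟩

theorem negTrace_inv (m : ℕ) : (negTrace m).lieInvariant (gl m) := by
  intro A B D
  simp only [negTrace_apply, Ring.lie_def, sub_mul, mul_sub, Matrix.trace_sub]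
  rw [show (A * B * D).trace = (B * (D * A)).trace by
    rw [mul_assoc, Matrix.trace_mul_comm, mul_assoc], mul_assoc B A D]
  ring

/-- The affine Lie algebra `ĝl_m`: the vector space `gl_m[t, t⁻¹] ⊕ ℂ C`, with bracket
`[A t^i, B t^j] = [A, B] t^(i+j) + i δ_{i,-j} tr(A B) C` and `C` central
(see `lie_glT_glT` and `lie_central`). -/
abbrev GlHat (m : ℕ) : Type :=
  LieAlgebra.ofTwoCocycle
    (LieAlgebra.LoopAlgebra.twoCocycleOfBilinear ℂ ℤ (gl m) (negTrace m)
      (negTrace_inv m) (negTrace_symm m))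

/-- The inclusion of the vector space `gl_m[t, t⁻¹]` in `ĝl_m`. -/
def ofCurrent (m : ℕ) : Current m →ₗ[ℂ] GlHat m where
  toFun P := LieAlgebra.ofProd _ (P, 0)
  map_add' P Q := by rw [← LieAlgebra.of_add]; simp
  map_smul' c P := by simp [← LieAlgebra.of_smul]

/-- The projection `ĝl_m → gl_m[t, t⁻¹]` with kernel `ℂ C`. -/
def toCurrent (m : ℕ) : GlHat m →ₗ[ℂ] Current m where
  toFun X := ((LieAlgebra.ofProd _).symm X).1
  map_add' P Q := by simp
  map_smul' c P := by simp

/-- The central element `C` of `ĝl_m`. -/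
def central (m : ℕ) : GlHat m :=
  LieAlgebra.ofProd _ (0, (TrivialLieModule.equiv ℂ (Current m) ℂ).symm 1)

/-- The element `A t^j` of `ĝl_m`, for `A ∈ gl_m` and `j ∈ ℤ`. -/
def glT (m : ℕ) (j : ℤ) : gl m →ₗ[ℂ] GlHat m :=
  ofCurrent m ∘ₗ TensorProduct.mk ℂ (AddMonoidAlgebra ℂ ℤ) (gl m) (AddMonoidAlgebra.single j 1)

theorem lie_central (m : ℕ) (X : GlHat m) : ⁅X, central m⁆ = 0 := by
  rw [LieAlgebra.bracket_ofTwoCocycle]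
  simp only [central, Equiv.symm_apply_apply, lie_zero, map_zero, trivial_lie_zero]
  simp only [add_zero, sub_zero]
  exact LieAlgebra.of_zero _

theorem toCurrent_lie (m : ℕ) (X Y : GlHat m) :
    toCurrent m ⁅X, Y⁆ = ⁅toCurrent m X, toCurrent m Y⁆ := rfl

theorem lie_glT_glT (m : ℕ) (i j : ℤ) (A B : gl m) :
    ⁅glT m i A, glT m j B⁆ =
      glT m (i + j) ⁅A, B⁆ + (if i = -j then (i : ℂ) * (A * B).trace else 0) • central m := by
  rw [LieAlgebra.bracket_ofTwoCocycle]
  simp only [glT, ofCurrent, central, LinearMap.comp_apply, TensorProduct.mk_apply,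
    LinearMap.coe_mk, AddHom.coe_mk, Equiv.symm_apply_apply, ← LieAlgebra.of_smul,
    ← LieAlgebra.of_add, lie_zero, sub_zero, add_zero, Prod.smul_mk, Prod.mk_add_mk, smul_zero,
    zero_add, LieAlgebra.ExtendScalars.bracket_tmul, AddMonoidAlgebra.single_mul_single, mul_one]
  refine congrArg _ (Prod.ext rfl ?_)
  simp only [LieAlgebra.LoopAlgebra.twoCocycleOfBilinear_coe,
    LieModule.Cohomology.twoCochain_val_apply,
    LieAlgebra.LoopAlgebra.twoCochainOfBilinear_apply_apply,
    LieAlgebra.LoopAlgebra.residuePairing_apply_apply,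
    LieAlgebra.LoopAlgebra.toFinsupp_single_tmul]
  rw [Finsupp.sum_single_index (by rw [map_zero, smul_zero])]
  refine Eq.trans (congrArg _ ?_)
    (LinearEquiv.map_smul (TrivialLieModule.equiv ℂ (Current m) ℂ).symm _ _)
  by_cases h : i = -j
  · subst h
    rw [Finsupp.single_eq_same, negTrace_apply, if_pos rfl, zsmul_eq_mul, smul_eq_mul]
    push_cast
    ring
  · rw [Finsupp.single_eq_of_ne (Ne.symm h), if_neg h, map_zero, LinearMap.zero_apply, smul_zero,
      zero_smul]

/-- The affine Lie algebra `ŝl_m`: the subalgebra of `ĝl_m` spanned by `sl_m[t, t⁻¹]` and `C`. -/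
def slHat (m : ℕ) : LieSubalgebra ℂ (GlHat m) where
  toSubmodule := Submodule.span ℂ
    (insert (central m) {X | ∃ (j : ℤ) (A : sl m), X = glT m j A})
  lie_mem' := by
    intro X Y hX hY
    show ⁅X, Y⁆ ∈ Submodule.span ℂ _
    induction hX, hY using Submodule.span_induction₂ with
    | mem_mem X Y hX hY =>
      rcases hX with rfl | ⟨i, A, rfl⟩
      · rw [← lie_skew, lie_central]; simp
      rcases hY with rfl | ⟨j, B, rfl⟩
      · rw [lie_central]; simp
      rw [lie_glT_glT]
      exact add_mem (Submodule.subset_span (Or.inr ⟨i + j, ⁅A, B⁆, rfl⟩))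
        (Submodule.smul_mem _ _ (Submodule.subset_span (Or.inl rfl)))
    | zero_left => simp
    | zero_right => simp
    | add_left x y z _ _ _ h1 h2 => rw [add_lie]; exact add_mem h1 h2
    | add_right x y z _ _ _ h1 h2 => rw [lie_add]; exact add_mem h1 h2
    | smul_left r x y _ _ h => rw [smul_lie]; exact Submodule.smul_mem _ _ h
    | smul_right r x y _ _ h => rw [lie_smul]; exact Submodule.smul_mem _ _ h

/-- The central element `C` of `ŝl_m`. -/
def slC (m : ℕ) : slHat m := ⟨central m, Submodule.subset_span (Or.inl rfl)⟩

/-- The element `A t^j` of `ŝl_m`, for `A ∈ sl_m` and `j ∈ ℤ`. -/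
def slT (m : ℕ) (j : ℤ) : sl m →ₗ[ℂ] slHat m where
  toFun A := ⟨glT m j A, Submodule.subset_span (Or.inr ⟨j, A, rfl⟩)⟩
  map_add' A B := Subtype.ext (map_add (glT m j) (A : gl m) B)
  map_smul' c A := Subtype.ext (map_smul (glT m j) c (A : gl m))

/-- The projection `gl_m → sl_m` along `ℂ I`, that is `A ↦ A - (tr A / m) I`. -/
def toSl (m : ℕ) : gl m →ₗ[ℂ] sl m :=
  LinearMap.codRestrict (sl m).toSubmodule
    (LinearMap.id - (Matrix.traceLinearMap (Fin m) ℂ ℂ).smulRight ((m : ℂ)⁻¹ • (1 : gl m)))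
    (by
      intro A
      show Matrix.traceLinearMap (Fin m) ℂ ℂ _ = 0
      rcases Nat.eq_zero_or_pos m with rfl | hm
      · simp [Matrix.trace]
      · have : (m : ℂ) ≠ 0 := by exact_mod_cast hm.ne'
        simp [this])

theorem coe_toSl (m : ℕ) (A : gl m) :
    (toSl m A : gl m) = A - (A.trace / m) • (1 : gl m) := by
  show A - A.trace • ((m : ℂ)⁻¹ • (1 : gl m)) = _
  rw [smul_smul, div_eq_mul_inv]

/-- The element `∑ E_ab ⊗ E_ba - (1/m) I ⊗ I` lies in `gl_m ⊗ sl_m`: it is equal to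
`∑ E_ab ⊗ E'_ba`, where `E'_ba` is the image of `E_ba` under the projection to `sl_m`. -/
theorem sum_tmul_toSl (m : ℕ) :
    ∑ a, ∑ b, (Matrix.single a b (1 : ℂ) : gl m) ⊗ₜ[ℂ] (toSl m (Matrix.single b a 1) : gl m) =
      ∑ a, ∑ b, (Matrix.single a b (1 : ℂ) : gl m) ⊗ₜ[ℂ] (Matrix.single b a 1 : gl m) -
        (1 / m : ℂ) • ((1 : gl m) ⊗ₜ[ℂ] (1 : gl m)) := by
  simp only [coe_toSl, TensorProduct.tmul_sub, Finset.sum_sub_distrib, sub_right_inj]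
  have h : (1 : gl m) = ∑ a, Matrix.single a a 1 := by
    ext i j
    simp [Matrix.sum_apply, Matrix.single_apply, Matrix.one_apply, ite_and]
  have h2 : ∀ a b : Fin m, (Matrix.single a b (1 : ℂ) : gl m).trace = if a = b then 1 else 0 := by
    intro a b
    split_ifs with hab
    · subst hab; simp
    · simp [Matrix.trace_single_eq_of_ne, hab]
  simp only [h2, ite_div, zero_div, ite_smul, zero_smul, TensorProduct.tmul_ite,
    Finset.sum_ite_eq', Finset.mem_univ, if_true]
  rw [← TensorProduct.sum_tmul, ← h, TensorProduct.tmul_smul]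


/-! ### Laurent polynomials -/

/-- The ring `ℂ[x₁, x₁⁻¹, …, x_N, x_N⁻¹]` of Laurent polynomials, realized as the group algebra of
`ℤ^N`; the exponent `e` stands for the monomial `∏ x_p ^ (e p)`. -/
abbrev Laurent (N : ℕ) : Type := AddMonoidAlgebra ℂ (Fin N → ℤ)

/-- The Laurent monomial `x_p ^ j`, for `j ∈ ℤ`. -/
def xPow {N : ℕ} (p : Fin N) (j : ℤ) : Laurent N := AddMonoidAlgebra.single (Pi.single p j) 1

/-- Permutation of the variables: the algebra endomorphism with `σ x_p = x_{σ p}`. -/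
def permL {N : ℕ} (σ : Equiv.Perm (Fin N)) : Laurent N →ₐ[ℂ] Laurent N :=
  AddMonoidAlgebra.mapDomainAlgHom ℂ ℂ (LinearMap.funLeft ℤ ℤ σ.symm).toAddMonoidHom

theorem permL_single {N : ℕ} (σ : Equiv.Perm (Fin N)) (e : Fin N → ℤ) (c : ℂ) :
    permL σ (AddMonoidAlgebra.single e c) = AddMonoidAlgebra.single (fun i => e (σ.symm i)) c := by
  simp [permL]
  rfl

theorem permL_xPow {N : ℕ} (σ : Equiv.Perm (Fin N)) (p : Fin N) (j : ℤ) :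
    permL σ (xPow p j) = xPow (σ p) j := by
  rw [xPow, permL_single, xPow]
  congr 1
  ext i
  simp only [Pi.single_apply, Equiv.symm_apply_eq]

/-- The derivation `∂_p`, sending a monomial with exponent `e` to `e_p` times the monomial with
exponent of `x_p` lowered by one. -/
def partialL {N : ℕ} (p : Fin N) : Laurent N →ₗ[ℂ] Laurent N :=
  Finsupp.lsum ℂ (fun e : Fin N → ℤ =>
    LinearMap.toSpanSingleton ℂ (Laurent N)
      (AddMonoidAlgebra.single (e - Pi.single p 1) (e p : ℂ))) ∘ₗ
    (AddMonoidAlgebra.coeffLinearEquiv ℂ).toLinearMap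

theorem partialL_single {N : ℕ} (p : Fin N) (e : Fin N → ℤ) (c : ℂ) :
    partialL p (AddMonoidAlgebra.single e c) =
      AddMonoidAlgebra.single (e - Pi.single p 1) (e p * c) := by
  simp [partialL, mul_comm]

theorem xPow_mul {N : ℕ} (p : Fin N) (i j : ℤ) :
    xPow p i * xPow p j = xPow p (i + j) := by
  simp [xPow, AddMonoidAlgebra.single_mul_single, ← Pi.single_add]

theorem xPow_zero {N : ℕ} (p : Fin N) : xPow p 0 = 1 := by
  simp [xPow, AddMonoidAlgebra.one_def]

/-- `f - σ_pr f` is divisible by `x_p - x_r`. -/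
theorem dvd_sub_permL {N : ℕ} (p r : Fin N) (f : Laurent N) :
    xPow p 1 - xPow r 1 ∣ f - permL (Equiv.swap p r) f := by
  set d : Laurent N := xPow p 1 - xPow r 1 with hd
  have hmul : ∀ f g : Laurent N, d ∣ f - permL (Equiv.swap p r) f →
      d ∣ g - permL (Equiv.swap p r) g → d ∣ f * g - permL (Equiv.swap p r) (f * g) := by
    intro f g hf hg
    rw [map_mul, show f * g - permL (Equiv.swap p r) f * permL (Equiv.swap p r) g =
      (f - permL (Equiv.swap p r) f) * g +
        permL (Equiv.swap p r) f * (g - permL (Equiv.swap p r) g) by ring]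
    exact dvd_add (Dvd.dvd.mul_right hf _) (Dvd.dvd.mul_left hg _)
  have hx1 : ∀ q : Fin N, d ∣ xPow q 1 - permL (Equiv.swap p r) (xPow q 1) := by
    intro q
    rw [permL_xPow]
    rcases eq_or_ne q p with rfl | hp
    · rw [Equiv.swap_apply_left]
    · rcases eq_or_ne q r with rfl | hr
      · rw [Equiv.swap_apply_right, hd, dvd_sub_comm]
      · rw [Equiv.swap_apply_of_ne_of_ne hp hr, sub_self]
        exact dvd_zero _
  have hxm : ∀ q : Fin N, d ∣ xPow q (-1) - permL (Equiv.swap p r) (xPow q (-1)) := by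
    intro q
    have h := hx1 q
    rw [permL_xPow] at h ⊢
    set s := Equiv.swap p r q
    have h1 : xPow q 1 * xPow q (-1) = 1 := by rw [xPow_mul]; exact xPow_zero q
    have h2 : xPow s 1 * xPow s (-1) = 1 := by rw [xPow_mul]; exact xPow_zero s
    have : xPow q (-1) - xPow s (-1) =
        (xPow q 1 - xPow s 1) * (-(xPow q (-1) * xPow s (-1))) := by
      linear_combination xPow s (-1) * h1 - xPow q (-1) * h2
    rw [this]
    exact Dvd.dvd.mul_right h _
  have hx : ∀ (q : Fin N) (j : ℤ), d ∣ xPow q j - permL (Equiv.swap p r) (xPow q j) := by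
    intro q j
    induction j using Int.induction_on with
    | zero => simp [xPow_zero]
    | succ i ih => rw [← xPow_mul]; exact hmul _ _ ih (hx1 q)
    | pred i ih => rw [sub_eq_add_neg (-(i : ℤ)), ← xPow_mul]; exact hmul _ _ ih (hxm q)
  have hmon : ∀ e : Fin N → ℤ, d ∣ AddMonoidAlgebra.single e 1 -
      permL (Equiv.swap p r) (AddMonoidAlgebra.single e 1) := by
    intro e
    induction e using Pi.single_induction with
    | zero => simp [← AddMonoidAlgebra.one_def]
    | add e e' h h' =>
      have : (AddMonoidAlgebra.single (e + e') 1 : Laurent N) =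
        AddMonoidAlgebra.single e 1 * AddMonoidAlgebra.single e' 1 := by
        simp [AddMonoidAlgebra.single_mul_single]
      rw [this]
      exact hmul _ _ h h'
    | single q j => exact hx q j
  induction f using AddMonoidAlgebra.induction_on with
  | of e => exact hmon _
  | add f g hf hg => rw [map_add, add_sub_add_comm]; exact dvd_add hf hg
  | smul c f hf => rw [map_smul, ← smul_sub]; rw [Algebra.smul_def]; exact Dvd.dvd.mul_left hf _

theorem xPow_sub_ne_zero {N : ℕ} {p r : Fin N} (h : p ≠ r) :
    (xPow p 1 - xPow r 1 : Laurent N) ≠ 0 := by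
  rw [sub_ne_zero, xPow, xPow, Ne, AddMonoidAlgebra.single_left_inj one_ne_zero]
  intro h'
  have := congrFun h' p
  simp [h] at this

/-- For `p ≠ r`, the operator `(x_p - x_r)⁻¹ (1 - σ_pr)` on Laurent polynomials
(see `mul_divDiff`). -/
def divDiff {N : ℕ} (p r : Fin N) : Laurent N →ₗ[ℂ] Laurent N :=
  if h : p = r then 0 else
  { toFun f := (dvd_sub_permL p r f).choose
    map_add' f g := by
      apply mul_left_cancel₀ (xPow_sub_ne_zero h)
      rw [mul_add, ← (dvd_sub_permL p r f).choose_spec, ← (dvd_sub_permL p r g).choose_spec,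
        ← (dvd_sub_permL p r (f + g)).choose_spec, map_add]
      ring
    map_smul' c f := by
      apply mul_left_cancel₀ (xPow_sub_ne_zero h)
      rw [RingHom.id_apply, mul_smul_comm, ← (dvd_sub_permL p r f).choose_spec,
        ← (dvd_sub_permL p r (c • f)).choose_spec, map_smul, smul_sub] }

theorem mul_divDiff {N : ℕ} {p r : Fin N} (h : p ≠ r) (f : Laurent N) :
    (xPow p 1 - xPow r 1) * divDiff p r f = f - permL (Equiv.swap p r) f := by
  rw [divDiff, dif_neg h]
  exact (dvd_sub_permL p r f).choose_spec.symm

/-! ### The tensor power of `ℂ^m` -/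

/-- The tensor product `(ℂ^m)^{⊗N}`. -/
abbrev Tens (m N : ℕ) : Type := ⨂[ℂ] _ : Fin N, (Fin m → ℂ)

/-- Permutation of the tensor factors: `σ` moves the `p`-th factor to the place `σ p`. -/
def permT {N : ℕ} (m : ℕ) (σ : Equiv.Perm (Fin N)) : Tens m N →ₗ[ℂ] Tens m N :=
  (PiTensorProduct.reindex ℂ (fun _ : Fin N => Fin m → ℂ) σ).toLinearMap

/-- The operator `A^{(p)}`: the matrix `A` acting in the `p`-th tensor factor. -/
def site {N : ℕ} (m : ℕ) (p : Fin N) : gl m →ₗ[ℂ] Module.End ℂ (Tens m N) :=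
  (PiTensorProduct.mapMultilinear ℂ (fun _ : Fin N => Fin m → ℂ) (fun _ => Fin m → ℂ)).toLinearMap
      (fun _ => LinearMap.id) p ∘ₗ
    (Matrix.toLin' : gl m ≃ₗ[ℂ] _).toLinearMap

theorem site_tprod {N : ℕ} (m : ℕ) (p : Fin N) (A : gl m) (v : Fin N → Fin m → ℂ) :
    site m p A (PiTensorProduct.tprod ℂ v) =
      PiTensorProduct.tprod ℂ (Function.update v p (A.mulVec (v p))) := by
  simp only [site, LinearMap.comp_apply, MultilinearMap.toLinearMap_apply,
    PiTensorProduct.mapMultilinear_apply, PiTensorProduct.map_tprod]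
  congr 1
  ext1 i
  rcases eq_or_ne i p with rfl | h
  · simp
  · simp [h]

theorem site_mul {N : ℕ} (m : ℕ) (p : Fin N) (A B : gl m) :
    site m p (A * B) = site m p A * site m p B := by
  refine PiTensorProduct.ext (MultilinearMap.ext fun v => ?_)
  simp [site_tprod]

theorem site_comm {N : ℕ} (m : ℕ) {p q : Fin N} (h : p ≠ q) (A B : gl m) :
    site m p A * site m q B = site m q B * site m p A := by
  refine PiTensorProduct.ext (MultilinearMap.ext fun v => ?_)
  simp [site_tprod, h, h.symm, Function.update_comm h]


theorem permT_tprod {N : ℕ} (m : ℕ) (σ : Equiv.Perm (Fin N)) (v : Fin N → Fin m → ℂ) :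
    permT m σ (PiTensorProduct.tprod ℂ v) = PiTensorProduct.tprod ℂ (fun i => v (σ.symm i)) :=
  PiTensorProduct.reindex_tprod σ v

/-! ### The space `W` -/

section Space

variable (m N : ℕ) (V : Type*) [AddCommGroup V] [Module ℂ V]

instance : AddCommGroup (Laurent N ⊗[ℂ] Tens m N) := TensorProduct.addCommGroup

/-- The vector space `W = ℂ[x₁^±1, …, x_N^±1] ⊗ (ℂ^m)^{⊗N} ⊗ V`. -/
abbrev WSpace : Type _ := (Laurent N ⊗[ℂ] Tens m N) ⊗[ℂ] V

end Space

/-- Substitution `t ↦ x_q`, from Laurent polynomials in `t` to those in `x₁, …, x_N`. -/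
def evalT {N : ℕ} (q : Fin N) : AddMonoidAlgebra ℂ ℤ →ₐ[ℂ] Laurent N :=
  AddMonoidAlgebra.mapDomainAlgHom ℂ ℂ (AddMonoidHom.single (fun _ : Fin N => ℤ) q)

/-- The action of `gl_m[t, t⁻¹]` on `ℂ[x₁^±1, …, x_N^±1] ⊗ (ℂ^m)^{⊗N}`, the tensor product of `N`
copies of `ℂ^m[t, t⁻¹]`: the element `A t^j` acts as `∑_q x_q^j ⊗ A^{(q)}`. -/
def currentAct (m N : ℕ) : Current m →ₗ[ℂ] Module.End ℂ (Laurent N ⊗[ℂ] Tens m N) :=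
  ∑ q : Fin N,
    TensorProduct.homTensorHomMap (RingHom.id ℂ) (Laurent N) (Tens m N) (Laurent N) (Tens m N) ∘ₗ
      TensorProduct.map ((LinearMap.mul ℂ (Laurent N)) ∘ₗ (evalT q).toLinearMap) (site m q)

theorem currentAct_tmul (m N : ℕ) (f : AddMonoidAlgebra ℂ ℤ) (A : gl m) :
    currentAct m N (f ⊗ₜ A) =
      ∑ q : Fin N, TensorProduct.map (LinearMap.mulLeft ℂ (evalT q f)) (site m q A) := by
  simp only [currentAct, LinearMap.sum_apply, LinearMap.comp_apply, TensorProduct.map_tmul,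
    TensorProduct.homTensorHomMap_apply]
  rfl

theorem evalT_single {N : ℕ} (q : Fin N) (j : ℤ) :
    evalT q (AddMonoidAlgebra.single j 1) = xPow q j := by
  rw [evalT, AddMonoidAlgebra.mapDomainAlgHom_apply, AddMonoidAlgebra.mapDomain_single]
  rfl

theorem currentAct_single (m N : ℕ) (j : ℤ) (A : gl m) :
    currentAct m N (AddMonoidAlgebra.single j 1 ⊗ₜ A) =
      ∑ q : Fin N, TensorProduct.map (LinearMap.mulLeft ℂ (xPow q j)) (site m q A) := by
  rw [currentAct_tmul]
  simp only [evalT_single]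

theorem currentAct_lie (m N : ℕ) (P Q : Current m) :
    currentAct m N ⁅P, Q⁆ = currentAct m N P * currentAct m N Q -
      currentAct m N Q * currentAct m N P := by
  induction P using TensorProduct.induction_on with
  | zero =>
    rw [show ⁅(0 : Current m), Q⁆ = 0 from zero_lie Q, map_zero, zero_mul, mul_zero, sub_zero]
  | add P P' h h' =>
    rw [show ⁅P + P', Q⁆ = ⁅P, Q⁆ + ⁅P', Q⁆ from add_lie P P' Q, map_add, h, h', map_add]
    noncomm_ring
  | tmul f A =>
    induction Q using TensorProduct.induction_on with
    | zero =>
      rw [show ⁅f ⊗ₜ[ℂ] A, (0 : Current m)⁆ = 0 from lie_zero (f ⊗ₜ[ℂ] A : Current m), map_zero,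
        zero_mul, mul_zero, sub_zero]
    | add Q Q' h h' =>
      rw [show ⁅f ⊗ₜ[ℂ] A, Q + Q'⁆ = ⁅f ⊗ₜ[ℂ] A, Q⁆ + ⁅f ⊗ₜ[ℂ] A, Q'⁆ from
        lie_add (f ⊗ₜ[ℂ] A : Current m) Q Q', map_add, h, h', map_add]
      noncomm_ring
    | tmul g B =>
      rw [LieAlgebra.ExtendScalars.bracket_tmul]
      simp only [currentAct_tmul, Ring.lie_def]
      rw [Finset.sum_mul_sum, Finset.sum_mul_sum, Finset.sum_comm (s := Finset.univ)
        (t := Finset.univ) (f := fun q r => TensorProduct.map (LinearMap.mulLeft ℂ (evalT q g)) _ *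
          TensorProduct.map (LinearMap.mulLeft ℂ (evalT r f)) _), ← Finset.sum_sub_distrib]
      refine Finset.sum_congr rfl fun q _ => ?_
      rw [← Finset.sum_sub_distrib, Finset.sum_eq_single q]
      · refine TensorProduct.ext' fun a v => ?_
        simp only [TensorProduct.map_tmul, LinearMap.sub_apply, Module.End.mul_apply,
          LinearMap.mulLeft_apply, map_mul, map_sub, site_mul, TensorProduct.tmul_sub]
        rw [mul_assoc, mul_left_comm (evalT q g)]
      · intro r _ hr
        refine TensorProduct.ext' fun a v => ?_
        have h := LinearMap.congr_fun (site_comm m hr B A) v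
        simp only [Module.End.mul_apply] at h
        simp only [TensorProduct.map_tmul, LinearMap.sub_apply, Module.End.mul_apply,
          LinearMap.mulLeft_apply, h, LinearMap.zero_apply]
        rw [mul_left_comm, sub_self]
      · simp

section Module

variable (m N : ℕ) (V : Type*) [AddCommGroup V] [Module ℂ V]
  [LieRingModule (slHat m) V] [LieModule ℂ (slHat m) V]

/-- The action of `ŝl_m` on `W`: the element `A t^j` acts as
`∑_q x_q^j ⊗ A^{(q)} ⊗ id + id ⊗ id ⊗ A t^j`, and `C` acts as `id ⊗ id ⊗ C`. -/
def slAct : slHat m →ₗ⁅ℂ⁆ Module.End ℂ (WSpace m N V) where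
  toFun X := TensorProduct.map (currentAct m N (toCurrent m X)) LinearMap.id +
    TensorProduct.map LinearMap.id (LieModule.toEnd ℂ (slHat m) V X)
  map_add' X Y := by
    simp only [show ((X + Y : slHat m) : GlHat m) = X + Y from rfl, map_add, TensorProduct.map_add_left,
      TensorProduct.map_add_right]
    abel
  map_smul' c X := by
    simp only [show ((c • X : slHat m) : GlHat m) = c • (X : GlHat m) from rfl, map_smul, TensorProduct.map_smul_left,
      TensorProduct.map_smul_right, RingHom.id_apply, smul_add]
  map_lie' {X Y} := by
    refine TensorProduct.ext' fun a v => ?_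
    simp [Ring.lie_def, toCurrent_lie, Module.End.mul_apply, currentAct_lie, TensorProduct.sub_tmul,
      TensorProduct.tmul_sub]
    abel

theorem slAct_slT (j : ℤ) (A : sl m) :
    slAct m N V (slT m j A) =
      ∑ q : Fin N, TensorProduct.map
        (TensorProduct.map (LinearMap.mulLeft ℂ (xPow q j)) (site m q A)) LinearMap.id +
      TensorProduct.map LinearMap.id (LieModule.toEnd ℂ (slHat m) V (slT m j A)) := by
  show TensorProduct.map (currentAct m N (AddMonoidAlgebra.single j 1 ⊗ₜ (A : gl m)))
    LinearMap.id + _ = _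
  rw [currentAct_single]
  refine TensorProduct.ext' fun a v => ?_
  simp only [LinearMap.add_apply, LinearMap.sum_apply, TensorProduct.map_tmul,
    TensorProduct.sum_tmul]

theorem slAct_slC :
    slAct m N V (slC m) =
      TensorProduct.map LinearMap.id (LieModule.toEnd ℂ (slHat m) V (slC m)) := by
  show TensorProduct.map (currentAct m N 0) LinearMap.id + _ = _
  rw [map_zero, TensorProduct.map_zero_left, zero_add]

/-- The subspace `q W`, where `q = t⁻¹ sl_m[t⁻¹]` is spanned by the elements `A t^j` with
`A ∈ sl_m` and `j < 0`: the span of the images of the operators by which `q` acts on `W`. -/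
def qW : Submodule ℂ (WSpace m N V) :=
  Submodule.span ℂ {w | ∃ X ∈ Submodule.span ℂ {X | ∃ j < (0 : ℤ), ∃ A : sl m, X = slT m j A},
    ∃ w' : WSpace m N V, w = slAct m N V X w'}

/-- The annihilation condition on `V`: every vector of `V` is annihilated by `t^i sl_m[t]` for some
degree `i`. -/
def IsSmooth : Prop :=
  ∀ v : V, ∃ i : ℤ, ∀ j : ℤ, i ≤ j → ∀ A : sl m, ⁅slT m j A, v⁆ = 0

/-- `V` has level `ℓ`: the central element `C` acts on `V` as the scalar `ℓ`. -/
def HasLevel (ℓ : ℂ) : Prop := ∀ v : V, ⁅slC m, v⁆ = ℓ • v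

/-! ### Operators on `W` -/

/-- Multiplication by `x_p ^ j` in the first tensor factor of `W`. -/
def opX (p : Fin N) (j : ℤ) : Module.End ℂ (WSpace m N V) :=
  TensorProduct.map (TensorProduct.map (LinearMap.mulLeft ℂ (xPow p j)) LinearMap.id) LinearMap.id

/-- The simultaneous permutation of `x₁, …, x_N` and of the `N` tensor factors `ℂ^m` of `W`. -/
def opPerm (σ : Equiv.Perm (Fin N)) : Module.End ℂ (WSpace m N V) :=
  TensorProduct.map (TensorProduct.map (permL σ).toLinearMap (permT m σ)) LinearMap.id

/-- The operator
`κ x_p ∂_p ⊗ id ⊗ id + ∑_{r ≠ p} x_p (x_p - x_r)⁻¹ (1 - σ_pr) ⊗ σ_pr ⊗ id` on `W`. -/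
def opDunkl (κ : ℂ) (p : Fin N) : Module.End ℂ (WSpace m N V) :=
  κ • TensorProduct.map (TensorProduct.map (LinearMap.mulLeft ℂ (xPow p 1) ∘ₗ partialL p)
      LinearMap.id) LinearMap.id +
    ∑ r ∈ Finset.univ.erase p,
      TensorProduct.map (TensorProduct.map (LinearMap.mulLeft ℂ (xPow p 1) ∘ₗ divDiff p r)
        (permT m (Equiv.swap p r))) LinearMap.id

/-- The operator
`x_p^{-i} ⊗ (∑_{a,b} E_ab^{(p)} ⊗ E_ba t^i - (1/m) id ⊗ I t^i)` on `W`. The expression in brackets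
is understood as the action of `∑_{a,b} E_ab ⊗ E_ba - (1/m) I ⊗ I`, an element of `gl_m ⊗ sl_m`
by `sum_tmul_toSl`, with the first tensor factor acting on the `p`-th factor `ℂ^m` and with the
second one, multiplied by `t^i`, acting on `V`. -/
def opGapTerm (p : Fin N) (i : ℕ) : Module.End ℂ (WSpace m N V) :=
  ∑ a : Fin m, ∑ b : Fin m,
    TensorProduct.map
      (TensorProduct.map (LinearMap.mulLeft ℂ (xPow p (-(i : ℤ))))
        (site m p (Matrix.single a b 1)))
      (LieModule.toEnd ℂ (slHat m) V (slT m i (toSl m (Matrix.single b a 1))))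

variable {m V}

theorem opGapTerm_finite (hV : IsSmooth m V) (p : Fin N) (w : WSpace m N V) :
    (Function.support fun i : ℕ => opGapTerm m N V p i w).Finite := by
  suffices h : ∃ n : ℕ, ∀ i ≥ n, opGapTerm m N V p i w = 0 by
    obtain ⟨n, hn⟩ := h
    refine (Set.finite_lt_nat n).subset fun i hi => ?_
    by_contra h
    exact hi (hn i (not_lt.1 h))
  induction w using TensorProduct.induction_on with
  | zero => exact ⟨0, fun i _ => map_zero _⟩
  | add x y hx hy =>
    obtain ⟨n, hn⟩ := hx
    obtain ⟨k, hk⟩ := hy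
    refine ⟨max n k, fun i hi => ?_⟩
    rw [map_add, hn i (le_trans (le_max_left _ _) hi), hk i (le_trans (le_max_right _ _) hi),
      add_zero]
  | tmul f v =>
    obtain ⟨n, hn⟩ := hV v
    refine ⟨n.toNat, fun i hi => ?_⟩
    simp only [opGapTerm, LinearMap.sum_apply, TensorProduct.map_tmul, LieModule.toEnd_apply_apply]
    refine Finset.sum_eq_zero fun a _ => Finset.sum_eq_zero fun b _ => ?_
    rw [hn i (by omega), TensorProduct.tmul_zero]

/-- The operator
`∑_{i ≥ 0} x_p^{-i} ⊗ (∑_{a,b} E_ab^{(p)} ⊗ E_ba t^i - (1/m) id ⊗ I t^i)` on `W`; on each vector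
only finitely many summands are non-zero. -/
def opGap (hV : IsSmooth m V) (p : Fin N) : Module.End ℂ (WSpace m N V) where
  toFun w := ∑ᶠ i : ℕ, opGapTerm m N V p i w
  map_add' x y := by
    simp only [map_add]
    exact finsum_add_distrib (opGapTerm_finite N hV p x) (opGapTerm_finite N hV p y)
  map_smul' c x := by
    simp only [map_smul, RingHom.id_apply]
    exact (smul_finsum' c (opGapTerm_finite N hV p x)).symm

/-- The modified Cherednik operator on `W`. -/
def opCherednik (hV : IsSmooth m V) (κ : ℂ) (p : Fin N) : Module.End ℂ (WSpace m N V) :=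
  opDunkl m N V κ p + opGap N hV p

end Module

/-! ### The trigonometric Cherednik algebra -/

/-- Generators of the trigonometric Cherednik algebra. -/
inductive Gen (N : ℕ) : Type
  | x (p : Fin N)
  | xinv (p : Fin N)
  | s (σ : Equiv.Perm (Fin N))
  | u (p : Fin N)

/-- The free algebra on the generators `x_p`, `x_p⁻¹`, `σ ∈ S_N` and `u_p`. -/
abbrev FreeGen (N : ℕ) : Type := FreeAlgebra ℂ (Gen N)

namespace FreeGen

variable {N : ℕ}

/-- The generator `x_p`. -/
def x (p : Fin N) : FreeGen N := FreeAlgebra.ι ℂ (Gen.x p)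

/-- The generator `x_p⁻¹`. -/
def xinv (p : Fin N) : FreeGen N := FreeAlgebra.ι ℂ (Gen.xinv p)

/-- The generator `σ`. -/
def s (σ : Equiv.Perm (Fin N)) : FreeGen N := FreeAlgebra.ι ℂ (Gen.s σ)

/-- The generator `u_p`. -/
def u (p : Fin N) : FreeGen N := FreeAlgebra.ι ℂ (Gen.u p)

/-- The element `z_p = u_p - σ_{1p} - … - σ_{p-1,p}`. -/
def z (p : Fin N) : FreeGen N := u p - ∑ r ∈ Finset.Iio p, s (Equiv.swap r p)

end FreeGen

open FreeGen in
/-- The defining relations of the trigonometric Cherednik algebra: those of the group algebra of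
`S_N`, those of the ring of Laurent polynomials, those of the degenerate affine Hecke algebra
(`u_comm`, `s_u`, `s_u_succ`, where `p' = p + 1`), and the cross relations. -/
inductive Rel (κ : ℂ) (N : ℕ) : FreeGen N → FreeGen N → Prop
  | s_one : Rel κ N (s 1) 1
  | s_mul (σ τ : Equiv.Perm (Fin N)) : Rel κ N (s (σ * τ)) (s σ * s τ)
  | x_comm (p q : Fin N) : Rel κ N (x p * x q) (x q * x p)
  | x_xinv (p : Fin N) : Rel κ N (x p * xinv p) 1
  | xinv_x (p : Fin N) : Rel κ N (xinv p * x p) 1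
  | u_comm (p q : Fin N) : Rel κ N (u p * u q) (u q * u p)
  | s_u (p p' q : Fin N) (hp : (p' : ℕ) = p + 1) (hq : q ≠ p) (hq' : q ≠ p') :
      Rel κ N (s (Equiv.swap p p') * u q) (u q * s (Equiv.swap p p'))
  | s_u_succ (p p' : Fin N) (hp : (p' : ℕ) = p + 1) :
      Rel κ N (s (Equiv.swap p p') * u p) (u p' * s (Equiv.swap p p') - 1)
  | s_x (σ : Equiv.Perm (Fin N)) (p : Fin N) : Rel κ N (s σ * x p * s σ⁻¹) (x (σ p))
  | z_x (p q : Fin N) (h : q ≠ p) :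
      Rel κ N (z p * x q - x q * z p) (-(x p * s (Equiv.swap p q)))
  | z_x_same (p : Fin N) :
      Rel κ N (z p * x p - x p * z p)
        (κ • x p + ∑ r ∈ Finset.univ.erase p, x p * s (Equiv.swap p r))

/-- The trigonometric Cherednik algebra `T_N` with the parameter `κ`. -/
abbrev TrigCherednik (κ : ℂ) (N : ℕ) : Type := RingQuot (Rel κ N)

/-- The quotient map from the free algebra to `T_N`. -/
abbrev toTrig (κ : ℂ) (N : ℕ) : FreeGen N →ₐ[ℂ] TrigCherednik κ N :=
  RingQuot.mkAlgHom ℂ (Rel κ N)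

/-- The homomorphism `ρ` is an action of `T_N` on `W` such that `x_p^±1` acts by multiplication,
`σ ∈ S_N` by the simultaneous permutation of the variables and of the tensor factors `ℂ^m`, and
`z_p` by the modified Cherednik operator. -/
structure IsCherednikAction {m N : ℕ} {V : Type*} [AddCommGroup V] [Module ℂ V]
    [LieRingModule (slHat m) V] [LieModule ℂ (slHat m) V] (hV : IsSmooth m V) (κ : ℂ)
    (ρ : TrigCherednik κ N →ₐ[ℂ] Module.End ℂ (WSpace m N V)) : Prop where
  map_x : ∀ p, ρ (toTrig κ N (FreeGen.x p)) = opX m N V p 1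
  map_xinv : ∀ p, ρ (toTrig κ N (FreeGen.xinv p)) = opX m N V p (-1)
  map_s : ∀ σ, ρ (toTrig κ N (FreeGen.s σ)) = opPerm m N V σ
  map_z : ∀ p, ρ (toTrig κ N (FreeGen.z p)) = opCherednik N hV κ p

end AffineCherednik

end

/-! Write Ω_{p,n} for `casimirW p n`, so that Z_p is a Dunkl-type operator plus the locally finite
sum of the x_p^{-i} Ω_{p,i} over i ≥ 0. That sum commutes with multiplication by Laurent
polynomials, so the cross relations between Z_p and x_q come from the Dunkl part alone, through the
twisted Leibniz rule for divided differences (`opDunkl_mul_mulW`). Equivariance under permutations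
is checked term by term.

The serious relation is the commutativity of the u_p, which amounts to [Z_p, Z_q] = (Z_q - Z_p)
σ_pq. The cross relations and equivariance already force the difference of the two sides to commute
with every x_r (`commute_defect_of_cross_relations`). Since W is generated over the Laurent
polynomials by the constants 1 ⊗ (ℂ^m)^{⊗N} ⊗ V, it suffices to test the relation on constants
(`eq_of_commute_mulW`). There the Dunkl operators vanish, and applied to x_q^{-n} times a constant
they give finite geometric sums. These match the terms produced by the Yang-Baxter type identity
[Ω_{p,i}, Ω_{q,j}] = P_pq (Ω_{p,i+j} - Ω_{q,i+j}), where P_pq permutes tensor factors only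
(`casimirW_mul_casimirW`, `opCherednik_commutator_apply`).

For the two statements about currents, the commutator of Z_p with A t^{-j}, j ≥ 0, is computed
exactly in `opCherednik_mul_slAct`; the infinite sum contributes a telescoping series of which j
terms survive. At j = 0 every correction disappears. For j > 0 the surviving terms act on V by
[E_ba, A] t^{i-j}; replacing this by the action on all of W minus the action on the tensor factors
(`casimirLieW_eq`) produces elements of q W, exchange terms that cancel those of the Dunkl part, and
a multiple of x_p^{-j} A^{(p)} coming from the Casimir element of ℂ^m. At level ℓ the total
coefficient of x_p^{-j} A^{(p)} is j (-κ + m + ℓ), zero exactly when ℓ = κ - m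
(`opCherednik_mem_qW`).

The x_p^{±1}, σ and z_p generate the algebra (`trig_induction`), so uniqueness, both stability
statements and functoriality need only be checked on these generators. -/

noncomputable section

namespace AffineCherednik

/-! ### Elementary operators on `W` -/

section Instances

variable (m N : ℕ) (V : Type*) [AddCommGroup V] [Module ℂ V]

/-- The ring of operators on `W`, with a semiring structure that unfolds to the standard one. -/
instance instRingEndW : Ring (Module.End ℂ (WSpace m N V)) :=
  { (inferInstance : Semiring (Module.End ℂ (WSpace m N V))),
    (inferInstance : Ring (Module.End ℂ (WSpace m N V))) with }

/-- This and the next two instances take the additive group, subtraction and negation from the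
single ring structure above. -/
instance instAddCommGroupEndW : AddCommGroup (Module.End ℂ (WSpace m N V)) :=
  (instRingEndW m N V).toAddCommGroup

instance instSubEndW : Sub (Module.End ℂ (WSpace m N V)) := (instRingEndW m N V).toSub

instance instNegEndW : Neg (Module.End ℂ (WSpace m N V)) := (instRingEndW m N V).toNeg

end Instances

section Operators

variable (m : ℕ) {N : ℕ} (V : Type*) [AddCommGroup V] [Module ℂ V]

/-- The operator `a ⊗ b ⊗ c` on `W`. -/
def tensorOp (a : Module.End ℂ (Laurent N)) (b : Module.End ℂ (Tens m N)) (c : Module.End ℂ V) :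
    Module.End ℂ (WSpace m N V) :=
  TensorProduct.map (TensorProduct.map a b) c

variable {m V} in
theorem tensorOp_mul (a a' : Module.End ℂ (Laurent N)) (b b' : Module.End ℂ (Tens m N))
    (c c' : Module.End ℂ V) :
    tensorOp m V a b c * tensorOp m V a' b' c' = tensorOp m V (a * a') (b * b') (c * c') := by
  simp only [tensorOp]
  rw [TensorProduct.map_mul, TensorProduct.map_mul]

variable {m V} in
theorem tensorOp_one : tensorOp (N := N) m V 1 1 1 = 1 := by
  simp only [tensorOp, TensorProduct.map_one]

/-- Multiplication by a Laurent polynomial, as an operator on `W`. -/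
def mulW : Laurent N →ₐ[ℂ] Module.End ℂ (WSpace m N V) where
  toFun f := tensorOp m V (LinearMap.mulLeft ℂ f) 1 1
  map_one' := by rw [LinearMap.mulLeft_one]; exact tensorOp_one
  map_mul' f g := by rw [tensorOp_mul, LinearMap.mulLeft_mul]; rfl
  map_zero' := by simp [tensorOp]
  map_add' f g := by
    rw [show LinearMap.mulLeft ℂ (f + g) = LinearMap.mulLeft ℂ f + LinearMap.mulLeft ℂ g from
      map_add (LinearMap.mul ℂ (Laurent N)) f g]
    simp [tensorOp, TensorProduct.map_add_left]
  commutes' c := by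
    have : LinearMap.mulLeft ℂ (algebraMap ℂ (Laurent N) c) = c • LinearMap.id := by
      refine LinearMap.ext fun g => ?_
      rw [LinearMap.mulLeft_apply, ← Algebra.smul_def]; rfl
    rw [this]
    simp only [tensorOp, TensorProduct.map_smul_left]
    rw [Algebra.algebraMap_eq_smul_one]
    exact congrArg _ tensorOp_one

/-- A matrix acting in the `p`-th factor of `(ℂ^m)^{⊗N}`, as an operator on `W`. -/
def siteW (p : Fin N) : gl m →ₗ[ℂ] Module.End ℂ (WSpace m N V) where
  toFun A := tensorOp m V 1 (site m p A) 1
  map_add' A B := by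
    simp only [tensorOp, map_add, TensorProduct.map_add_left, TensorProduct.map_add_right]
  map_smul' c A := by
    simp only [tensorOp, map_smul, TensorProduct.map_smul_left, TensorProduct.map_smul_right,
      RingHom.id_apply]

/-- The permutation of the variables, as an operator on `W`. -/
def permLW (σ : Equiv.Perm (Fin N)) : Module.End ℂ (WSpace m N V) :=
  tensorOp m V (permL σ).toLinearMap 1 1

/-- The permutation of the factors of `(ℂ^m)^{⊗N}`, as an operator on `W`. -/
def permTW (σ : Equiv.Perm (Fin N)) : Module.End ℂ (WSpace m N V) :=
  tensorOp m V 1 (permT m σ) 1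

/-- The operator `x_p ∂_p` on `W`. -/
def eulerW (p : Fin N) : Module.End ℂ (WSpace m N V) :=
  tensorOp m V (LinearMap.mulLeft ℂ (xPow p 1) ∘ₗ partialL p) 1 1

/-- The operator `x_p (x_p - x_r)⁻¹ (1 - σ_pr)` on `W`, with `σ_pr` permuting the variables. -/
def divDiffW (p r : Fin N) : Module.End ℂ (WSpace m N V) :=
  tensorOp m V (LinearMap.mulLeft ℂ (xPow p 1) ∘ₗ divDiff p r) 1 1

section
variable [LieRingModule (slHat m) V] [LieModule ℂ (slHat m) V] (N)

/-- The action of `ŝl_m` on the factor `V` of `W`. -/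
def actV : slHat m →ₗ[ℂ] Module.End ℂ (WSpace m N V) where
  toFun X := tensorOp m V 1 1 (LieModule.toEnd ℂ (slHat m) V X)
  map_add' A B := by
    simp only [tensorOp, map_add, TensorProduct.map_add_right]
  map_smul' c A := by
    simp only [tensorOp, map_smul, TensorProduct.map_smul_right, RingHom.id_apply]

end

/-! ### Relations between the elementary operators -/

variable {m V}

theorem permL_mul (σ τ : Equiv.Perm (Fin N)) :
    ((permL σ).toLinearMap * (permL τ).toLinearMap : Module.End ℂ (Laurent N)) =
      (permL (σ * τ)).toLinearMap := by
  refine AddMonoidAlgebra.lhom_ext' fun e => LinearMap.ext fun c => ?_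
  simp [permL_single]
  rfl

theorem permT_mul (σ τ : Equiv.Perm (Fin N)) :
    (permT m σ * permT m τ : Module.End ℂ (Tens m N)) = permT m (σ * τ) := by
  refine PiTensorProduct.ext (MultilinearMap.ext fun v => ?_)
  simp [permT_tprod]
  rfl

theorem permL_one : (permL (1 : Equiv.Perm (Fin N))).toLinearMap = 1 := by
  refine AddMonoidAlgebra.lhom_ext' fun e => LinearMap.ext fun c => ?_
  simp [permL_single]
  rfl

theorem permT_one : permT m (1 : Equiv.Perm (Fin N)) = 1 := by
  refine PiTensorProduct.ext (MultilinearMap.ext fun v => ?_)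
  simp [permT_tprod]
  rfl

theorem permT_mul_site (σ : Equiv.Perm (Fin N)) (p : Fin N) (A : gl m) :
    (permT m σ * site m p A : Module.End ℂ (Tens m N)) = site m (σ p) A * permT m σ := by
  refine PiTensorProduct.ext (MultilinearMap.ext fun v => ?_)
  simp only [LinearMap.compMultilinearMap_apply, Module.End.mul_apply, permT_tprod, site_tprod]
  congr 1
  ext1 i
  rcases eq_or_ne i (σ p) with rfl | h
  · simp
  · have : σ.symm i ≠ p := fun h' => h (by simp [← h'])
    simp [h, this]

theorem siteW_apply (p : Fin N) (A : gl m) :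
    siteW m V p A = tensorOp m V 1 (site m p A) 1 := rfl

theorem permTW_mul_siteW (σ : Equiv.Perm (Fin N)) (p : Fin N) (A : gl m) :
    permTW m V σ * siteW m V p A = siteW m V (σ p) A * permTW m V σ := by
  simp only [permTW, siteW_apply, tensorOp_mul, permT_mul_site]

theorem siteW_mul (p : Fin N) (A B : gl m) :
    siteW m V p (A * B) = siteW m V p A * siteW m V p B := by
  simp only [siteW_apply, tensorOp_mul, site_mul, mul_one]

theorem siteW_comm {p q : Fin N} (h : p ≠ q) (A B : gl m) :
    siteW m V p A * siteW m V q B = siteW m V q B * siteW m V p A := by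
  simp only [siteW_apply, tensorOp_mul, site_comm m h]

theorem mulW_mul_siteW (f : Laurent N) (p : Fin N) (A : gl m) :
    mulW m V f * siteW m V p A = siteW m V p A * mulW m V f := by
  change tensorOp m V _ _ _ * tensorOp m V _ _ _ = tensorOp m V _ _ _ * tensorOp m V _ _ _
  simp only [tensorOp_mul, mul_one, one_mul]

theorem mulW_mul_permTW (f : Laurent N) (σ : Equiv.Perm (Fin N)) :
    mulW m V f * permTW m V σ = permTW m V σ * mulW m V f := by
  change tensorOp m V _ _ _ * tensorOp m V _ _ _ = tensorOp m V _ _ _ * tensorOp m V _ _ _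
  simp only [tensorOp_mul, mul_one, one_mul]

theorem permLW_mul_permTW (σ τ : Equiv.Perm (Fin N)) :
    permLW m V σ * permTW m V τ = permTW m V τ * permLW m V σ := by
  simp only [permLW, permTW, tensorOp_mul, mul_one, one_mul]

theorem permLW_mul_siteW (σ : Equiv.Perm (Fin N)) (p : Fin N) (A : gl m) :
    permLW m V σ * siteW m V p A = siteW m V p A * permLW m V σ := by
  change tensorOp m V _ _ _ * tensorOp m V _ _ _ = tensorOp m V _ _ _ * tensorOp m V _ _ _
  simp only [tensorOp_mul, mul_one, one_mul]

theorem divDiffW_mul_siteW (p r q : Fin N) (A : gl m) :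
    divDiffW m V p r * siteW m V q A = siteW m V q A * divDiffW m V p r := by
  change tensorOp m V _ _ _ * tensorOp m V _ _ _ = tensorOp m V _ _ _ * tensorOp m V _ _ _
  simp only [tensorOp_mul, mul_one, one_mul]

theorem divDiffW_mul_permTW (p r : Fin N) (σ : Equiv.Perm (Fin N)) :
    divDiffW m V p r * permTW m V σ = permTW m V σ * divDiffW m V p r := by
  simp only [divDiffW, permTW, tensorOp_mul, mul_one, one_mul]

theorem eulerW_mul_siteW (p q : Fin N) (A : gl m) :
    eulerW m V p * siteW m V q A = siteW m V q A * eulerW m V p := by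
  change tensorOp m V _ _ _ * tensorOp m V _ _ _ = tensorOp m V _ _ _ * tensorOp m V _ _ _
  simp only [tensorOp_mul, mul_one, one_mul]

theorem permLW_mul_mulW (σ : Equiv.Perm (Fin N)) (f : Laurent N) :
    permLW m V σ * mulW m V f = mulW m V (permL σ f) * permLW m V σ := by
  change tensorOp m V _ _ _ * tensorOp m V _ _ _ = tensorOp m V _ _ _ * tensorOp m V _ _ _
  simp only [tensorOp_mul, mul_one]
  congr 1
  refine LinearMap.ext fun g => ?_
  exact map_mul (permL σ) f g

section
variable [LieRingModule (slHat m) V] [LieModule ℂ (slHat m) V]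

theorem actV_tmul (X : slHat m) (a : Laurent N ⊗[ℂ] Tens m N) (v : V) :
    actV m N V X (a ⊗ₜ v) = a ⊗ₜ ⁅X, v⁆ := by
  change TensorProduct.map (TensorProduct.map 1 1) _ _ = _
  rw [TensorProduct.map_one]
  rfl

theorem actV_lie (X Y : slHat m) :
    actV m N V ⁅X, Y⁆ = actV m N V X * actV m N V Y - actV m N V Y * actV m N V X := by
  refine TensorProduct.ext' fun a v => ?_
  simp only [actV_tmul, lie_lie, Module.End.mul_apply, LinearMap.sub_apply,
    TensorProduct.tmul_sub]

theorem mulW_mul_actV (f : Laurent N) (X : slHat m) :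
    mulW m V f * actV m N V X = actV m N V X * mulW m V f := by
  change tensorOp m V _ _ _ * tensorOp m V _ _ _ = tensorOp m V _ _ _ * tensorOp m V _ _ _
  simp only [tensorOp_mul, mul_one, one_mul]

theorem siteW_mul_actV (p : Fin N) (A : gl m) (X : slHat m) :
    siteW m V p A * actV m N V X = actV m N V X * siteW m V p A := by
  change tensorOp m V _ _ _ * tensorOp m V _ _ _ = tensorOp m V _ _ _ * tensorOp m V _ _ _
  simp only [tensorOp_mul, mul_one, one_mul]

theorem eulerW_mul_actV (p : Fin N) (X : slHat m) :
    eulerW m V p * actV m N V X = actV m N V X * eulerW m V p := by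
  change tensorOp m V _ _ _ * tensorOp m V _ _ _ = tensorOp m V _ _ _ * tensorOp m V _ _ _
  simp only [tensorOp_mul, mul_one, one_mul]

theorem divDiffW_mul_actV (p r : Fin N) (X : slHat m) :
    divDiffW m V p r * actV m N V X = actV m N V X * divDiffW m V p r := by
  change tensorOp m V _ _ _ * tensorOp m V _ _ _ = tensorOp m V _ _ _ * tensorOp m V _ _ _
  simp only [tensorOp_mul, mul_one, one_mul]

theorem permTW_mul_actV (σ : Equiv.Perm (Fin N)) (X : slHat m) :
    permTW m V σ * actV m N V X = actV m N V X * permTW m V σ := by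
  change tensorOp m V _ _ _ * tensorOp m V _ _ _ = tensorOp m V _ _ _ * tensorOp m V _ _ _
  simp only [tensorOp_mul, mul_one, one_mul]

theorem permLW_mul_actV (σ : Equiv.Perm (Fin N)) (X : slHat m) :
    permLW m V σ * actV m N V X = actV m N V X * permLW m V σ := by
  change tensorOp m V _ _ _ * tensorOp m V _ _ _ = tensorOp m V _ _ _ * tensorOp m V _ _ _
  simp only [tensorOp_mul, mul_one, one_mul]

end

/-! ### Divided differences -/

/-- Twisted Leibniz rule: f g - σf σg = f (g - σg) + (f - σf) σg. The permutation left on the second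
factor is the origin of the group elements in the cross relations. -/
theorem divDiff_mul {p r : Fin N} (h : p ≠ r) (f g : Laurent N) :
    divDiff p r (f * g) = f * divDiff p r g + divDiff p r f * permL (Equiv.swap p r) g := by
  apply mul_left_cancel₀ (xPow_sub_ne_zero h)
  rw [mul_divDiff h, mul_add, mul_left_comm, mul_divDiff h, ← mul_assoc, mul_divDiff h, map_mul]
  ring

/-- Laurent polynomials form a domain, so a divided difference may be identified by multiplying a
candidate by the denominator. -/
theorem divDiff_eq {p r : Fin N} (h : p ≠ r) {f g : Laurent N}
    (hg : (xPow p 1 - xPow r 1) * g = f - permL (Equiv.swap p r) f) : divDiff p r f = g := by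
  apply mul_left_cancel₀ (xPow_sub_ne_zero h)
  rw [mul_divDiff h, hg]

theorem divDiff_one {p r : Fin N} (h : p ≠ r) : divDiff p r (1 : Laurent N) = 0 :=
  divDiff_eq h (by simp)

theorem divDiff_xPow_left {p r : Fin N} (h : p ≠ r) : divDiff p r (xPow p 1) = 1 :=
  divDiff_eq h (by simp [permL_xPow])

theorem divDiff_xPow_right {p r : Fin N} (h : p ≠ r) (j : ℤ) :
    divDiff p r (xPow r j) = -divDiff p r (xPow p j) :=
  divDiff_eq h (by rw [mul_neg, mul_divDiff h]; simp [permL_xPow])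

theorem divDiff_xPow_of_ne {p r q : Fin N} (h : p ≠ r) (hp : q ≠ p) (hr : q ≠ r) (j : ℤ) :
    divDiff p r (xPow q j) = 0 :=
  divDiff_eq h (by simp [permL_xPow, Equiv.swap_apply_of_ne_of_ne hp hr])

/-- A finite geometric sum, checked by multiplying back by x_p - x_r. Negative powers are the ones
needed, both for the summands of Z_p and for currents in q. -/
theorem xPow_mul_divDiff_xPow_neg {p r : Fin N} (h : p ≠ r) (n : ℕ) :
    xPow p 1 * divDiff p r (xPow p (-(n : ℤ))) =
      -∑ a ∈ Finset.range n, xPow p (-(a : ℤ)) * xPow r ((a : ℤ) - n) := by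
  apply mul_left_cancel₀ (xPow_sub_ne_zero h)
  rw [mul_left_comm, mul_divDiff h, permL_xPow, Equiv.swap_apply_left, mul_neg, Finset.mul_sum,
    ← Finset.sum_neg_distrib]
  -- Each summand is a difference of consecutive values of a ↦ x_p^{1-a} x_r^{a-n}, so the sum
  -- telescopes to the values at n and 0.
  have key : ∀ a ∈ Finset.range n, -((xPow p 1 - xPow r 1 : Laurent N) *
      (xPow p (-(a : ℤ)) * xPow r ((a : ℤ) - n))) =
      xPow p (1 - ((a + 1 : ℕ) : ℤ)) * xPow r (((a + 1 : ℕ) : ℤ) - n) -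
        xPow p (1 - (a : ℤ)) * xPow r ((a : ℤ) - n) := by
    intro a _
    rw [show (1 - ((a + 1 : ℕ) : ℤ)) = -a by push_cast; ring,
      show (((a + 1 : ℕ) : ℤ) - n) = 1 + (a - n) by push_cast; ring,
      show (1 - (a : ℤ)) = 1 + -a by ring, ← xPow_mul p 1, ← xPow_mul r 1]
    ring
  rw [Finset.sum_congr rfl key,
    Finset.sum_range_sub (fun a : ℕ => (xPow p (1 - (a : ℤ)) * xPow r ((a : ℤ) - n) : Laurent N))]
  simp only [Nat.cast_zero, sub_zero, sub_self, zero_sub, xPow_zero, mul_one, mul_sub, xPow_mul]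
  rfl

theorem divDiffW_mul_mulW {p r : Fin N} (h : p ≠ r) (f : Laurent N) :
    divDiffW m V p r * mulW m V f = mulW m V f * divDiffW m V p r +
      mulW m V (xPow p 1 * divDiff p r f) * permLW m V (Equiv.swap p r) := by
  refine TensorProduct.ext' fun a v => ?_
  induction a using TensorProduct.induction_on with
  | zero => simp
  | add a b ha hb => rw [TensorProduct.add_tmul, map_add, map_add, ha, hb]
  | tmul g t =>
    change (_ ⊗ₜ[ℂ] t) ⊗ₜ[ℂ] v = (_ ⊗ₜ[ℂ] t) ⊗ₜ[ℂ] v + (_ ⊗ₜ[ℂ] t) ⊗ₜ[ℂ] v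
    rw [← TensorProduct.add_tmul, ← TensorProduct.add_tmul]
    congr 2
    simp only [LinearMap.comp_apply, LinearMap.mulLeft_apply, divDiff_mul h,
      AlgHom.toLinearMap_apply]
    ring

/-- With g = x_p (x_p^j - x_r^j)/(x_p - x_r), the first summand is g (1 - σ_pr), with σ_pr acting on
variables only. This lets g σ_pr be traded for g minus a divided difference in
`opDunkl_mul_currentW`. -/
theorem mulW_mul_divDiffW {p r : Fin N} (h : p ≠ r) (j : ℤ) :
    mulW m V (xPow p j - xPow r j) * divDiffW m V p r +
      mulW m V (xPow p 1 * divDiff p r (xPow p j)) * permLW m V (Equiv.swap p r) =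
      mulW m V (xPow p 1 * divDiff p r (xPow p j)) := by
  refine TensorProduct.ext' fun a v => ?_
  induction a using TensorProduct.induction_on with
  | zero => simp
  | add a b ha hb => rw [TensorProduct.add_tmul, map_add, map_add, ha, hb]
  | tmul g t =>
    change (_ ⊗ₜ[ℂ] t) ⊗ₜ[ℂ] v + (_ ⊗ₜ[ℂ] t) ⊗ₜ[ℂ] v = (_ ⊗ₜ[ℂ] t) ⊗ₜ[ℂ] v
    rw [← TensorProduct.add_tmul, ← TensorProduct.add_tmul]
    congr 2
    have h1 := mul_divDiff h (xPow p j)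
    have h2 := mul_divDiff h g
    rw [permL_xPow, Equiv.swap_apply_left] at h1
    simp only [LinearMap.comp_apply, LinearMap.mulLeft_apply, AlgHom.toLinearMap_apply]
    rw [← h1]
    linear_combination (xPow p 1 * divDiff p r (xPow p j)) * h2

theorem xPow_mul_partialL_mul (p : Fin N) (f g : Laurent N) :
    xPow p 1 * partialL p (f * g) =
      f * (xPow p 1 * partialL p g) + xPow p 1 * partialL p f * g := by
  induction f using AddMonoidAlgebra.induction_linear with
  | zero => simp
  | add f f' h h' => rw [add_mul, map_add, mul_add, h, h', map_add]; ring
  | single e c =>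
    induction g using AddMonoidAlgebra.induction_linear with
    | zero => simp
    | add f f' h h' => rw [mul_add, map_add, mul_add, h, h', map_add]; ring
    | single e' c' =>
      simp only [xPow, AddMonoidAlgebra.single_mul_single, partialL_single]
      rw [show Pi.single p 1 + (e + e' - Pi.single p 1) = e + e' by abel,
        show e + (Pi.single p 1 + (e' - Pi.single p 1)) = e + e' by abel,
        show Pi.single p 1 + (e - Pi.single p 1) + e' = e + e' by abel,
        ← AddMonoidAlgebra.single_add]
      congr 1
      simp
      ring

theorem xPow_mul_partialL_xPow (p q : Fin N) (j : ℤ) :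
    xPow p 1 * partialL p (xPow q j) = if q = p then (j : ℂ) • xPow p j else 0 := by
  rw [xPow, xPow, partialL_single, AddMonoidAlgebra.single_mul_single]
  split_ifs with h
  · subst h
    simp [xPow]
  · simp [Ne.symm h]

theorem eulerW_mul_mulW (p : Fin N) (f : Laurent N) :
    eulerW m V p * mulW m V f = mulW m V f * eulerW m V p +
      mulW m V (xPow p 1 * partialL p f) := by
  refine TensorProduct.ext' fun a v => ?_
  induction a using TensorProduct.induction_on with
  | zero => simp
  | add a b ha hb => rw [TensorProduct.add_tmul, map_add, map_add, ha, hb]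
  | tmul g t =>
    change (_ ⊗ₜ[ℂ] t) ⊗ₜ[ℂ] v = (_ ⊗ₜ[ℂ] t) ⊗ₜ[ℂ] v + (_ ⊗ₜ[ℂ] t) ⊗ₜ[ℂ] v
    rw [← TensorProduct.add_tmul, ← TensorProduct.add_tmul]
    congr 2
    exact xPow_mul_partialL_mul p f g

end Operators

/-! ### A consequence of the cross relations -/

section CrossRelations

variable {R ι : Type*} [Ring R] [Algebra ℂ R] [Fintype ι] [DecidableEq ι] {κ : ℂ}
  {Z X : ι → R} {S : Equiv.Perm ι → R}

/-- In the presence of the cross relations, the defect of the relation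
`[z_p, z_q] = (z_q - z_p) σ_pq` commutes with all the `x_r`. -/
theorem commute_defect_of_cross_relations
    (hS : ∀ σ τ, S (σ * τ) = S σ * S τ) (hS1 : S 1 = 1)
    (hSX : ∀ σ p, S σ * X p = X (σ p) * S σ) (hSZ : ∀ σ p, S σ * Z p = Z (σ p) * S σ)
    (hZX : ∀ p q, q ≠ p → Z p * X q = X q * Z p - X p * S (Equiv.swap p q))
    (hZX' : ∀ p, Z p * X p =
      X p * Z p + κ • X p + ∑ r ∈ Finset.univ.erase p, X p * S (Equiv.swap p r))
    {p q : ι} (hpq : p ≠ q) (r : ι) :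
    (Z p * Z q - Z q * Z p - (Z q - Z p) * S (Equiv.swap p q)) * X r =
      X r * (Z p * Z q - Z q * Z p - (Z q - Z p) * S (Equiv.swap p q)) := by
  have hconj : ∀ {a b c : ι}, c ≠ a → c ≠ b →
      S (Equiv.swap a c) * S (Equiv.swap a b) = S (Equiv.swap a b) * S (Equiv.swap b c) := by
    intro a b c hca hcb
    rw [← hS, ← hS, Equiv.mul_swap_eq_swap_mul (Equiv.swap a b) b c, Equiv.swap_apply_right,
      Equiv.swap_apply_of_ne_of_ne hca hcb]
  have hsq : ∀ a b : ι, S (Equiv.swap a b) * S (Equiv.swap a b) = 1 := by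
    intro a b
    rw [← hS, Equiv.swap_mul_self, hS1]
  -- The case where the variable carries one of the two indices. Only the first index is treated:
  -- exchanging the indices changes the sign of the defect.
  have same : ∀ {a b : ι}, a ≠ b →
      (Z a * Z b - Z b * Z a - (Z b - Z a) * S (Equiv.swap a b)) * X a =
        X a * (Z a * Z b - Z b * Z a - (Z b - Z a) * S (Equiv.swap a b)) := by
    intro a b hab
    set s := S (Equiv.swap a b) with hs
    have e1 : Z b * X a = X a * Z b - X b * s := by
      rw [hZX b a hab, Equiv.swap_comm]
    have e2 : Z a * X b = X b * Z a - X a * s := hZX a b hab.symm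
    have e3 : s * X a = X b * s := by rw [hs, hSX, Equiv.swap_apply_left]
    have e4 : s * Z a = Z b * s := by rw [hs, hSZ, Equiv.swap_apply_left]
    have e5 : s * Z b = Z a * s := by rw [hs, hSZ, Equiv.swap_apply_right]
    have e6 : s * s = 1 := hsq a b
    -- The transpositions joining `a`, respectively `b`, to a third index are kept as the blocks `U`
    -- and `U'`: `s` intertwines them (`e9`), and `U` commutes with `Z b` (`e10`).
    set U := ∑ t ∈ (Finset.univ.erase a).erase b, S (Equiv.swap a t) with hU
    set U' := ∑ t ∈ (Finset.univ.erase a).erase b, S (Equiv.swap b t) with hU'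
    have e7 : Z a * X a = X a * Z a + κ • X a + X a * (s + U) := by
      rw [hZX' a, ← Finset.mul_sum, hU, hs,
        Finset.add_sum_erase _ (fun t => S (Equiv.swap a t)) (by simp [hab.symm])]
    have e8 : Z b * X b = X b * Z b + κ • X b + X b * (s + U') := by
      rw [hZX' b, ← Finset.mul_sum, hU', Finset.erase_right_comm, hs, Equiv.swap_comm a b,
        Finset.add_sum_erase _ (fun t => S (Equiv.swap b t)) (by simp [hab])]
    have e9 : U' * s = s * U := by
      rw [hU, hU', Finset.sum_mul, Finset.mul_sum]
      refine Finset.sum_congr rfl fun t ht => ?_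
      simp only [Finset.mem_erase, Finset.mem_univ, and_true] at ht
      rw [hs, Equiv.swap_comm a b, hconj ht.1 ht.2]
    have e10 : U * Z b = Z b * U := by
      rw [hU, Finset.sum_mul, Finset.mul_sum]
      refine Finset.sum_congr rfl fun t ht => ?_
      simp only [Finset.mem_erase, Finset.mem_univ, and_true] at ht
      rw [hSZ, Equiv.swap_apply_of_ne_of_ne hab.symm (Ne.symm ht.1)]
    have k : κ • X a * Z b = X a * (κ • Z b) := by rw [smul_mul_assoc, mul_smul_comm]
    have k' : Z b * (κ • X a) = κ • (X a * Z b) - κ • (X b * s) := by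
      rw [mul_smul_comm, e1, smul_sub]
    have k1 : κ • X b * s = κ • (X b * s) := smul_mul_assoc _ _ _
    have k2 : κ • X a * Z b = κ • (X a * Z b) := smul_mul_assoc _ _ _
    have l1 : Z a * Z b * X a = X a * Z a * Z b + κ • (X a * Z b) + X a * Z a * s +
        X a * Z b * U - X b * Z a * s + X a := by
      rw [mul_assoc, e1, mul_sub, ← mul_assoc, ← mul_assoc, e7, e2, add_mul, add_mul, k2,
        sub_mul, mul_assoc (X a) s s, e6, mul_one, mul_assoc (X a) (s + U), add_mul, e5, e10,
        mul_add]
      noncomm_ring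
    have l2 : Z b * Z a * X a = X a * Z b * Z a - X b * Z b * s + κ • (X a * Z b) -
        κ • (X b * s) + X a * Z b * s - X b + X a * Z b * U - X b * s * U := by
      rw [mul_assoc, e7, mul_add, mul_add, k', ← mul_assoc, ← mul_assoc, e1, sub_mul, sub_mul,
        mul_assoc (X b) s (Z a), e4, mul_add, mul_add, mul_assoc (X b) s s, e6]
      noncomm_ring
    have l3 : Z b * s * X a = X b * Z b * s + κ • (X b * s) + X b + X b * s * U := by
      rw [mul_assoc, e3, ← mul_assoc, e8, add_mul, add_mul, k1, mul_assoc (X b) (s + U'), add_mul,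
        e6, e9, mul_add]
      noncomm_ring
    have l4 : Z a * s * X a = X b * Z a * s - X a := by
      rw [mul_assoc, e3, ← mul_assoc, e2, sub_mul, mul_assoc (X a) s s, e6, mul_one]
    rw [sub_mul, sub_mul, l1, l2, sub_mul, sub_mul, l3, l4]
    noncomm_ring
  rcases eq_or_ne r p with rfl | hp
  · exact same hpq
  rcases eq_or_ne r q with rfl | hq
  · have h := same hpq.symm
    rw [Equiv.swap_comm r p] at h
    have e : Z p * Z r - Z r * Z p - (Z r - Z p) * S (Equiv.swap p r) =
        -(Z r * Z p - Z p * Z r - (Z p - Z r) * S (Equiv.swap p r)) := by noncomm_ring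
    rw [e, neg_mul, h, mul_neg]
  -- With `r` a third index, the terms linear in Z cancel between the two products. The terms with
  -- two transpositions cancel against those of (Z_q - Z_p) s, because a s = s b and b s = s a.
  set s := S (Equiv.swap p q) with hs
  set a := S (Equiv.swap p r) with ha
  set b := S (Equiv.swap q r) with hb
  have e1 : Z p * X r = X r * Z p - X p * a := hZX p r hp
  have e2 : Z q * X r = X r * Z q - X q * b := hZX q r hq
  have e3 : Z p * X q = X q * Z p - X p * s := hZX p q hpq.symm
  have e4 : Z q * X p = X p * Z q - X q * s := by rw [hZX q p hpq, Equiv.swap_comm]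
  have e5 : a * Z q = Z q * a := by
    rw [ha, hSZ, Equiv.swap_apply_of_ne_of_ne hpq.symm hq.symm]
  have e6 : b * Z p = Z p * b := by
    rw [hb, hSZ, Equiv.swap_apply_of_ne_of_ne hpq hp.symm]
  have e7 : s * X r = X r * s := by
    rw [hs, hSX, Equiv.swap_apply_of_ne_of_ne hp hq]
  have e8 : a * s = s * b := hconj hp hq
  have e9 : b * s = s * a := by rw [hs, Equiv.swap_comm p q]; exact hconj hq hp
  have l1 : Z p * Z q * X r =
      X r * Z p * Z q - X p * Z q * a - X q * Z p * b + X p * s * b := by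
    rw [mul_assoc, e2, mul_sub, ← mul_assoc, ← mul_assoc, e1, e3, sub_mul, sub_mul,
      mul_assoc (X p) a, e5]
    noncomm_ring
  have l2 : Z q * Z p * X r =
      X r * Z q * Z p - X q * Z p * b - X p * Z q * a + X q * s * a := by
    rw [mul_assoc, e1, mul_sub, ← mul_assoc, ← mul_assoc, e2, e4, sub_mul, sub_mul,
      mul_assoc (X q) b, e6]
    noncomm_ring
  have l3 : Z q * s * X r = X r * Z q * s - X q * s * a := by
    rw [mul_assoc, e7, ← mul_assoc, e2, sub_mul, mul_assoc (X q), e9, mul_assoc (X q)]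
  have l4 : Z p * s * X r = X r * Z p * s - X p * s * b := by
    rw [mul_assoc, e7, ← mul_assoc, e1, sub_mul, mul_assoc (X p), e8, mul_assoc (X p)]
  rw [sub_mul, sub_mul, l1, l2, sub_mul, sub_mul, l3, l4]
  noncomm_ring

end CrossRelations

/-! ### The Casimir tensor -/

section Casimir

variable {m : ℕ} {R : Type*} [Semiring R] [Algebra ℂ R]

theorem single_mul_eq_sum (A : gl m) (a b : Fin m) :
    (Matrix.single a b 1 * A : gl m) = ∑ c, A b c • Matrix.single a c 1 := by
  ext i j
  simp [Matrix.sum_apply, Matrix.single_apply, Matrix.mul_apply, ite_and]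

theorem mul_single_eq_sum (A : gl m) (a b : Fin m) :
    (A * Matrix.single a b 1 : gl m) = ∑ c, A c a • Matrix.single c b 1 := by
  ext i j
  simp [Matrix.sum_apply, Matrix.single_apply, Matrix.mul_apply, ite_and]

/-- Invariance of the Casimir tensor: right multiplication on one leg equals left multiplication on
the other. `sum_mul_single` is the mirror statement. -/
theorem sum_single_mul (F T : gl m →ₗ[ℂ] R) (A : gl m) :
    ∑ a, ∑ b, F (Matrix.single a b 1 * A) * T (Matrix.single b a 1) =
      ∑ a, ∑ b, F (Matrix.single a b 1) * T (A * Matrix.single b a 1) := by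
  simp only [single_mul_eq_sum, mul_single_eq_sum, map_sum, map_smul, Finset.sum_mul,
    Finset.mul_sum, smul_mul_assoc, mul_smul_comm]
  exact Finset.sum_congr rfl fun a _ => Finset.sum_comm

theorem sum_mul_single (F T : gl m →ₗ[ℂ] R) (A : gl m) :
    ∑ a, ∑ b, F (A * Matrix.single a b 1) * T (Matrix.single b a 1) =
      ∑ a, ∑ b, F (Matrix.single a b 1) * T (Matrix.single b a 1 * A) := by
  simp only [single_mul_eq_sum, mul_single_eq_sum, map_sum, map_smul, Finset.sum_mul,
    Finset.mul_sum, smul_mul_assoc, mul_smul_comm]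
  rw [Finset.sum_comm, Finset.sum_comm (s := Finset.univ (α := Fin m))
    (f := fun a b => ∑ c, A a c • (F (Matrix.single a b 1) * T (Matrix.single b c 1)))]
  refine Finset.sum_congr rfl fun b _ => ?_
  rw [Finset.sum_comm]

theorem one_eq_sum_single : (1 : gl m) = ∑ a, Matrix.single a a 1 := by
  ext i j
  simp [Matrix.sum_apply, Matrix.single_apply, Matrix.one_apply, ite_and]

/-- The Casimir element of gl_m acts on ℂ^m by m. This is the source of the shift by m in the level
κ - m. -/
theorem sum_single_mul_single :
    ∑ a, ∑ b, (Matrix.single b a 1 * Matrix.single a b 1 : gl m) = (m : ℂ) • (1 : gl m) := by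
  simp only [Matrix.single_mul_single_same, mul_one, ← one_eq_sum_single]
  simp [← Nat.cast_smul_eq_nsmul ℂ]

theorem sum_single_mul_mul_single (A : gl m) :
    ∑ a, ∑ b, (Matrix.single b a 1 * A * Matrix.single a b 1 : gl m) = A.trace • (1 : gl m) := by
  have h : ∀ a b : Fin m, (Matrix.single b a 1 * A * Matrix.single a b 1 : gl m) =
      A a a • Matrix.single b b 1 := by
    intro a b
    rw [single_mul_eq_sum, Finset.sum_mul, Finset.sum_eq_single a]
    · simp
    · intro c _ hc
      rw [smul_mul_assoc, Matrix.single_mul_single_of_ne _ _ _ _ hc, smul_zero]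
    · simp
  simp only [h, ← Finset.smul_sum, ← one_eq_sum_single, Matrix.trace, Finset.sum_smul]
  rfl

/-- The scalar part removed from A pairs to zero with a traceless matrix. -/
theorem trace_toSl_mul (A : gl m) (B : sl m) :
    ((toSl m A : gl m) * (B : gl m)).trace = (A * (B : gl m)).trace := by
  have hB : (B : gl m).trace = 0 := B.2
  rw [coe_toSl, sub_mul, Matrix.trace_sub, smul_mul_assoc, one_mul, Matrix.trace_smul, hB,
    smul_zero, sub_zero]

/-- The bases E_ab and E_ba are dual for the trace form, so contracting the Casimir tensor with A
gives back A. -/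
theorem sum_trace_single_mul (F : gl m →ₗ[ℂ] R) (A : gl m) :
    ∑ a, ∑ b, (Matrix.single b a 1 * A : gl m).trace • F (Matrix.single a b 1) = F A := by
  have h : ∀ a b : Fin m, (Matrix.single b a 1 * A : gl m).trace = A a b := by
    intro a b
    rw [single_mul_eq_sum, Matrix.trace_sum, Finset.sum_eq_single b]
    · simp
    · intro c _ hc
      rw [Matrix.trace_smul, Matrix.trace_single_eq_of_ne _ _ _ hc.symm, smul_zero]
    · simp
  simp only [h, ← map_smul, ← map_sum]
  congr 1
  ext i j
  simp [Matrix.sum_apply, Matrix.single_apply, ite_and]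

theorem toSl_coe (A : sl m) : toSl m (A : gl m) = A := by
  have hA : (A : gl m).trace = 0 := A.2
  exact Subtype.ext (by rw [coe_toSl, hA]; simp)

/-- The scalar corrections are central and a commutator is already traceless, so projecting to sl_m
is compatible with brackets. -/
theorem lie_toSl (A B : gl m) : ⁅toSl m A, toSl m B⁆ = toSl m (A * B - B * A) := by
  refine Subtype.ext ?_
  rw [LieSubalgebra.coe_bracket, Ring.lie_def, coe_toSl, coe_toSl, coe_toSl, Matrix.trace_sub,
    Matrix.trace_mul_comm A B, sub_self, zero_div, zero_smul, sub_zero]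
  simp only [sub_mul, mul_sub, smul_mul_assoc, mul_smul_comm, one_mul, mul_one, smul_sub]
  rw [smul_comm ((B : gl m).trace / (m : ℂ)) ((A : gl m).trace / (m : ℂ))]
  abel

theorem lie_slT (i j : ℤ) (A B : sl m) :
    ⁅slT m i A, slT m j B⁆ = slT m (i + j) ⁅A, B⁆ +
      (if i = -j then (i : ℂ) * ((A : gl m) * (B : gl m)).trace else 0) • slC m :=
  Subtype.ext (lie_glT_glT m i j A B)

end Casimir

section Operators

variable {m N : ℕ} {V : Type*} [AddCommGroup V] [Module ℂ V]

/-! ### Permutations and the current action -/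

/-- The Casimir tensor acts on ℂ^m ⊗ ℂ^m as the flip; expanding the two vectors in the standard
basis and using multilinearity shows it. This identity turns commutators of currents into
permutations of the factors. -/
theorem permT_swap {p q : Fin N} (h : p ≠ q) :
    permT m (Equiv.swap p q) =
      ∑ a, ∑ b, site m p (Matrix.single a b 1) * site m q (Matrix.single b a 1) := by
  refine PiTensorProduct.ext (MultilinearMap.ext fun v => ?_)
  simp only [LinearMap.compMultilinearMap_apply, LinearMap.sum_apply, Module.End.mul_apply,
    site_tprod, permT_tprod, Function.update_of_ne h]
  have e' : ∀ (a b : Fin m) (u : Fin m → ℂ),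
      (Matrix.single a b (1 : ℂ)).mulVec u = u b • Pi.single a 1 := by
    intro a b u
    rw [Matrix.single_mulVec]
    ext i
    simp [Pi.single_apply, Function.update_apply]
  simp only [e']
  have e : (fun i => v ((Equiv.swap p q).symm i)) =
      Function.update (Function.update v q (∑ b, v p b • Pi.single b (1 : ℂ))) p
        (∑ a, v q a • Pi.single a (1 : ℂ)) := by
    rw [← pi_eq_sum_univ' (v p), ← pi_eq_sum_univ' (v q)]
    ext1 i
    rcases eq_or_ne i p with rfl | hp
    · simp
    rcases eq_or_ne i q with rfl | hq
    · simp [hp]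
    · simp [hp, hq, Equiv.swap_apply_of_ne_of_ne hp hq]
  rw [e, MultilinearMap.map_update_sum]
  refine Finset.sum_congr rfl fun a _ => ?_
  rw [Function.update_comm h.symm, MultilinearMap.map_update_sum]
  refine Finset.sum_congr rfl fun b _ => ?_
  rw [MultilinearMap.map_update_smul, MultilinearMap.map_update_smul,
    Function.update_comm h (v q a • _), MultilinearMap.map_update_smul,
    Function.update_comm h.symm (v q a • _), MultilinearMap.map_update_smul,
    Function.update_comm h]

theorem permTW_swap {p q : Fin N} (h : p ≠ q) :
    permTW m V (Equiv.swap p q) =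
      ∑ a, ∑ b, siteW m V p (Matrix.single a b 1) * siteW m V q (Matrix.single b a 1) := by
  simp only [siteW_apply, tensorOp_mul, mul_one]
  rw [permTW, permT_swap h]
  have e : ∀ {n : ℕ} (f : Fin n → Module.End ℂ (Tens m N)),
      tensorOp m V 1 (∑ i, f i) 1 = ∑ i, tensorOp m V 1 (f i) 1 := by
    intro n f
    exact map_sum (AddMonoidHom.mk' (fun b => tensorOp m V 1 b 1) fun b b' => by
      simp only [tensorOp, TensorProduct.map_add_left, TensorProduct.map_add_right]) f _
  simp only [e]

theorem opPerm_eq (σ : Equiv.Perm (Fin N)) : opPerm m N V σ = permLW m V σ * permTW m V σ := by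
  rw [permLW, permTW, tensorOp_mul]
  rfl

theorem opPerm_mul (σ τ : Equiv.Perm (Fin N)) :
    opPerm m N V (σ * τ) = opPerm m N V σ * opPerm m N V τ := by
  rw [show opPerm m N V σ = tensorOp m V (permL σ).toLinearMap (permT m σ) 1 from rfl,
    show opPerm m N V τ = tensorOp m V (permL τ).toLinearMap (permT m τ) 1 from rfl, tensorOp_mul,
    permL_mul, permT_mul, mul_one]
  rfl

theorem opPerm_one : opPerm m N V 1 = 1 := by
  rw [show opPerm m N V 1 = tensorOp m V (permL 1).toLinearMap (permT m 1) 1 from rfl,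
    permL_one, permT_one, tensorOp_one]

theorem opPerm_mul_mulW (σ : Equiv.Perm (Fin N)) (f : Laurent N) :
    opPerm m N V σ * mulW m V f = mulW m V (permL σ f) * opPerm m N V σ := by
  rw [opPerm_eq, mul_assoc, ← mulW_mul_permTW, ← mul_assoc, permLW_mul_mulW, mul_assoc]

theorem opPerm_mul_siteW (σ : Equiv.Perm (Fin N)) (p : Fin N) (A : gl m) :
    opPerm m N V σ * siteW m V p A = siteW m V (σ p) A * opPerm m N V σ := by
  rw [opPerm_eq, mul_assoc, permTW_mul_siteW, ← mul_assoc, permLW_mul_siteW, mul_assoc]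

theorem permLW_mul_eulerW (σ : Equiv.Perm (Fin N)) (p : Fin N) :
    permLW m V σ * eulerW m V p = eulerW m V (σ p) * permLW m V σ := by
  change tensorOp m V _ _ _ * tensorOp m V _ _ _ = tensorOp m V _ _ _ * tensorOp m V _ _ _
  simp only [tensorOp_mul]
  congr 1
  refine AddMonoidAlgebra.lhom_ext' fun e => LinearMap.ext fun c => ?_
  simp [partialL_single, permL_single, xPow, AddMonoidAlgebra.single_mul_single]

/-- Conjugation by σ carries the transposition of p and r, as well as the denominator, to those of σ
p and σ r. -/
theorem permL_divDiff (σ : Equiv.Perm (Fin N)) {p r : Fin N} (h : p ≠ r) (f : Laurent N) :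
    permL σ (divDiff p r f) = divDiff (σ p) (σ r) (permL σ f) := by
  refine (divDiff_eq (fun h' => h (σ.injective h')) ?_).symm
  have e := LinearMap.congr_fun (permL_mul σ (Equiv.swap p r)) f
  rw [Equiv.mul_swap_eq_swap_mul, ← permL_mul] at e
  simp only [Module.End.mul_apply, AlgHom.toLinearMap_apply] at e
  rw [← e, ← map_sub, ← mul_divDiff h, map_mul, map_sub, permL_xPow, permL_xPow]

theorem permLW_mul_divDiffW (σ : Equiv.Perm (Fin N)) {p r : Fin N} (h : p ≠ r) :
    permLW m V σ * divDiffW m V p r = divDiffW m V (σ p) (σ r) * permLW m V σ := by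
  change tensorOp m V _ _ _ * tensorOp m V _ _ _ = tensorOp m V _ _ _ * tensorOp m V _ _ _
  simp only [tensorOp_mul]
  congr 1
  refine LinearMap.ext fun f => ?_
  simp only [Module.End.mul_apply, LinearMap.comp_apply, LinearMap.mulLeft_apply,
    AlgHom.toLinearMap_apply, map_mul, permL_xPow, permL_divDiff σ h]

theorem permTW_mul (σ τ : Equiv.Perm (Fin N)) :
    permTW m V σ * permTW m V τ = permTW m V (σ * τ) := by
  simp only [permTW, tensorOp_mul, permT_mul, mul_one]

theorem opDunkl_eq (κ : ℂ) (p : Fin N) :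
    opDunkl m N V κ p = κ • eulerW m V p +
      ∑ r ∈ Finset.univ.erase p, divDiffW m V p r * permTW m V (Equiv.swap p r) := by
  simp only [divDiffW, permTW, tensorOp_mul]
  rfl

theorem permTW_mul_eulerW (σ : Equiv.Perm (Fin N)) (p : Fin N) :
    permTW m V σ * eulerW m V p = eulerW m V p * permTW m V σ := by
  simp only [permTW, eulerW, tensorOp_mul, mul_one, one_mul]

theorem opPerm_mul_eulerW (σ : Equiv.Perm (Fin N)) (p : Fin N) :
    opPerm m N V σ * eulerW m V p = eulerW m V (σ p) * opPerm m N V σ := by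
  rw [opPerm_eq, mul_assoc, permTW_mul_eulerW, ← mul_assoc, permLW_mul_eulerW, mul_assoc]

theorem opPerm_mul_divDiffW (σ : Equiv.Perm (Fin N)) {p r : Fin N} (h : p ≠ r) :
    opPerm m N V σ * (divDiffW m V p r * permTW m V (Equiv.swap p r)) =
      divDiffW m V (σ p) (σ r) * permTW m V (Equiv.swap (σ p) (σ r)) * opPerm m N V σ := by
  have e : permTW m V σ * permTW m V (Equiv.swap p r) =
      permTW m V (Equiv.swap (σ p) (σ r)) * permTW m V σ := by
    rw [permTW_mul, permTW_mul, Equiv.mul_swap_eq_swap_mul]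
  rw [opPerm_eq, mul_assoc, ← mul_assoc (permTW m V σ), ← divDiffW_mul_permTW,
    mul_assoc (divDiffW m V p r), e, ← mul_assoc, permLW_mul_divDiffW σ h, mul_assoc, mul_assoc,
    ← mul_assoc (permLW m V σ), permLW_mul_permTW, mul_assoc]

theorem opPerm_mul_opDunkl (κ : ℂ) (σ : Equiv.Perm (Fin N)) (p : Fin N) :
    opPerm m N V σ * opDunkl m N V κ p = opDunkl m N V κ (σ p) * opPerm m N V σ := by
  have h1 := opPerm_mul_eulerW (m := m) (V := V) σ p
  have h2 : ∀ r ∈ Finset.univ.erase p,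
      opPerm m N V σ * (divDiffW m V p r * permTW m V (Equiv.swap p r)) =
        divDiffW m V (σ p) (σ r) * permTW m V (Equiv.swap (σ p) (σ r)) * opPerm m N V σ :=
    fun r hr => opPerm_mul_divDiffW σ (Finset.ne_of_mem_erase hr).symm
  have h3 : ∑ r ∈ Finset.univ.erase p, divDiffW m V (σ p) (σ r) *
      permTW m V (Equiv.swap (σ p) (σ r)) * opPerm m N V σ =
      ∑ r ∈ Finset.univ.erase (σ p), divDiffW m V (σ p) r *
        permTW m V (Equiv.swap (σ p) r) * opPerm m N V σ := by
    refine Finset.sum_bijective σ σ.bijective (fun r => ?_) fun r _ => rfl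
    simp only [Finset.mem_erase, Finset.mem_univ, and_true, Ne, σ.injective.eq_iff]
  rw [opDunkl_eq, opDunkl_eq, mul_add, add_mul, mul_smul_comm, smul_mul_assoc, h1, Finset.mul_sum,
    Finset.sum_congr rfl h2, Finset.sum_mul, h3]

/-- The variable swap left by the twisted Leibniz rule meets the factor permutation already present
in the Dunkl term; together they form the simultaneous permutation by which 𝔖_N acts on W. -/
theorem opDunkl_mul_mulW (κ : ℂ) (p : Fin N) (f : Laurent N) :
    opDunkl m N V κ p * mulW m V f = mulW m V f * opDunkl m N V κ p +
      κ • mulW m V (xPow p 1 * partialL p f) +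
      ∑ r ∈ Finset.univ.erase p,
        mulW m V (xPow p 1 * divDiff p r f) * opPerm m N V (Equiv.swap p r) := by
  have h : ∀ r ∈ Finset.univ.erase p,
      divDiffW m V p r * permTW m V (Equiv.swap p r) * mulW m V f =
        mulW m V f * (divDiffW m V p r * permTW m V (Equiv.swap p r)) +
        mulW m V (xPow p 1 * divDiff p r f) * opPerm m N V (Equiv.swap p r) := by
    intro r hr
    have hr : p ≠ r := (Finset.ne_of_mem_erase hr).symm
    rw [mul_assoc, ← mulW_mul_permTW, ← mul_assoc, divDiffW_mul_mulW hr, add_mul, opPerm_eq]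
    simp only [mul_assoc]
  rw [opDunkl_eq, add_mul, mul_add, smul_mul_assoc, mul_smul_comm, eulerW_mul_mulW, smul_add,
    Finset.sum_mul, Finset.sum_congr rfl h, Finset.sum_add_distrib, Finset.mul_sum]
  abel

variable (m V) in
/-- The action of `A t^j` on the first two factors of `W`. -/
def currentW (j : ℤ) (A : gl m) : Module.End ℂ (WSpace m N V) :=
  ∑ q : Fin N, mulW m V (xPow q j) * siteW m V q A

theorem opPerm_mul_currentW (σ : Equiv.Perm (Fin N)) (j : ℤ) (A : gl m) :
    opPerm m N V σ * currentW m V j A = currentW m V j A * opPerm m N V σ := by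
  rw [currentW, Finset.mul_sum, Finset.sum_mul]
  refine Finset.sum_equiv σ (by simp) fun q _ => ?_
  rw [← mul_assoc, opPerm_mul_mulW, mul_assoc, opPerm_mul_siteW, permL_xPow, mul_assoc]

/-- The Euler part differentiates x_p^j. In a divided-difference term with index r, the sites p and
r exchange matrices but not variables, and the resulting mismatch is what remains in the last sum.
-/
theorem opDunkl_mul_currentW (κ : ℂ) (p : Fin N) (j : ℤ) (A : gl m) :
    opDunkl m N V κ p * currentW m V j A = currentW m V j A * opDunkl m N V κ p +
      (κ * j) • (mulW m V (xPow p j) * siteW m V p A) +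
      ∑ r ∈ Finset.univ.erase p, mulW m V (xPow p 1 * divDiff p r (xPow p j)) *
        (siteW m V r A - siteW m V p A) * permTW m V (Equiv.swap p r) := by
  have h1 : eulerW m V p * currentW m V j A = currentW m V j A * eulerW m V p +
      (j : ℂ) • (mulW m V (xPow p j) * siteW m V p A) := by
    have : ∀ q, eulerW m V p * (mulW m V (xPow q j) * siteW m V q A) =
        mulW m V (xPow q j) * siteW m V q A * eulerW m V p +
          if q = p then (j : ℂ) • (mulW m V (xPow p j) * siteW m V p A) else 0 := by
      intro q
      rw [← mul_assoc, eulerW_mul_mulW, add_mul, mul_assoc, eulerW_mul_siteW,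
        xPow_mul_partialL_xPow, ← mul_assoc]
      congr 1
      split_ifs with h
      · rw [h, map_smul, smul_mul_assoc]
      · rw [map_zero, zero_mul]
    rw [currentW, Finset.mul_sum, Finset.sum_congr rfl fun q _ => this q, Finset.sum_add_distrib,
      Finset.sum_mul, Finset.sum_ite_eq', if_pos (Finset.mem_univ p)]
  have h2 : ∀ r ∈ Finset.univ.erase p,
      divDiffW m V p r * permTW m V (Equiv.swap p r) * currentW m V j A =
        currentW m V j A * (divDiffW m V p r * permTW m V (Equiv.swap p r)) +
        mulW m V (xPow p 1 * divDiff p r (xPow p j)) *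
          (siteW m V r A - siteW m V p A) * permTW m V (Equiv.swap p r) := by
    intro r hr
    have hpr : p ≠ r := (Finset.ne_of_mem_erase hr).symm
    set P := permTW m V (Equiv.swap p r) with hP
    set D := divDiffW m V p r with hD
    set g := xPow p 1 * divDiff p r (xPow p j) with hg
    have h3 : ∀ q, D * P * (mulW m V (xPow q j) * siteW m V q A) =
        mulW m V (xPow q j) * siteW m V (Equiv.swap p r q) A * (D * P) +
          mulW m V (xPow p 1 * divDiff p r (xPow q j)) * siteW m V (Equiv.swap p r q) A *
            (permLW m V (Equiv.swap p r) * P) := by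
      intro q
      rw [mul_assoc D, ← mul_assoc P, hP, ← mulW_mul_permTW, mul_assoc _ (permTW _ _ _),
        permTW_mul_siteW, ← mul_assoc D, hD, divDiffW_mul_mulW hpr, add_mul]
      congr 1
      · simp only [mul_assoc]
        rw [← mul_assoc (divDiffW _ _ _ _) (siteW _ _ _ _), divDiffW_mul_siteW, mul_assoc]
      · simp only [mul_assoc]
        rw [← mul_assoc (permLW _ _ _) (siteW _ _ _ _), permLW_mul_siteW, mul_assoc]
    have h4 : ∀ q ∈ (Finset.univ.erase p).erase r,
        D * P * (mulW m V (xPow q j) * siteW m V q A) =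
          mulW m V (xPow q j) * siteW m V q A * (D * P) := by
      intro q hq
      have hqr := Finset.ne_of_mem_erase hq
      have hqp := Finset.ne_of_mem_erase (Finset.mem_of_mem_erase hq)
      rw [h3, Equiv.swap_apply_of_ne_of_ne hqp hqr, divDiff_xPow_of_ne hpr hqp hqr, mul_zero,
        map_zero, zero_mul, zero_mul, add_zero]
    have h5 := mulW_mul_divDiffW (m := m) (V := V) hpr j
    rw [← hD, ← hg] at h5
    have h6 : mulW m V g * permLW m V (Equiv.swap p r) =
        mulW m V g - mulW m V (xPow p j - xPow r j) * D := eq_sub_of_add_eq' h5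
    -- Eliminating the variable swap restores the correct pairing of x_p^j with A^{(p)} and of x_r^j
    -- with A^{(r)} in front of `D * P`, so the main terms recombine into the current.
    have h7 : ∀ q, mulW m V g * siteW m V q A * (permLW m V (Equiv.swap p r) * P) =
        mulW m V g * siteW m V q A * P -
          (mulW m V (xPow p j) - mulW m V (xPow r j)) * siteW m V q A * (D * P) := by
      intro q
      rw [mulW_mul_siteW, mul_assoc (siteW _ _ _ _), ← mul_assoc (mulW _ _ _), h6, map_sub,
        ← mulW_mul_siteW, sub_mul (mulW _ _ _) (mulW _ _ _) (siteW _ _ _ _), mulW_mul_siteW,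
        mulW_mul_siteW, mulW_mul_siteW]
      noncomm_ring
    rw [currentW, Finset.mul_sum, Finset.sum_mul, ← Finset.add_sum_erase _ _ (Finset.mem_univ p),
      ← Finset.add_sum_erase _ _ hr,
      ← Finset.add_sum_erase Finset.univ _ (Finset.mem_univ p),
      ← Finset.add_sum_erase (Finset.univ.erase p) _ hr, Finset.sum_congr rfl h4, h3, h3,
      Equiv.swap_apply_left, Equiv.swap_apply_right, divDiff_xPow_right hpr, mul_neg, map_neg,
      neg_mul, neg_mul, ← hg, h7, h7]
    noncomm_ring
  rw [opDunkl_eq, add_mul, smul_mul_assoc, h1, Finset.sum_mul, Finset.sum_congr rfl h2,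
    Finset.sum_add_distrib, mul_add, Finset.mul_sum, mul_smul_comm, smul_add, mul_smul]
  abel

end Operators

section Gap

variable {m N : ℕ} {V : Type*} [AddCommGroup V] [Module ℂ V]
  [LieRingModule (slHat m) V] [LieModule ℂ (slHat m) V]

/-! ### Casimir operators on `W` -/

variable (m N V) in
/-- The action on `V` of `A t^n`, where `A` is projected to `sl_m`, as an operator on `W`. -/
def actT (n : ℤ) : gl m →ₗ[ℂ] Module.End ℂ (WSpace m N V) := actV m N V ∘ₗ slT m n ∘ₗ toSl m

theorem actT_apply (n : ℤ) (A : gl m) : actT m N V n A = actV m N V (slT m n (toSl m A)) := rfl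

theorem actT_coe (n : ℤ) (A : sl m) : actT m N V n (A : gl m) = actV m N V (slT m n A) := by
  rw [actT_apply, toSl_coe]

theorem actT_mul_actT (i j : ℤ) (A B : gl m) :
    actT m N V i A * actT m N V j B = actT m N V j B * actT m N V i A +
      actT m N V (i + j) (A * B - B * A) +
      (if i = -j then (i : ℂ) * ((toSl m A : gl m) * (toSl m B : gl m)).trace else 0) •
        actV m N V (slC m) := by
  have h := actV_lie (N := N) (V := V) (slT m i (toSl m A)) (slT m j (toSl m B))
  rw [lie_slT, lie_toSl, map_add, map_smul] at h
  simp only [actT_apply]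
  rw [add_assoc, h]
  abel

theorem siteW_mul_actT (p : Fin N) (A : gl m) (n : ℤ) (B : gl m) :
    siteW m V p A * actT m N V n B = actT m N V n B * siteW m V p A := siteW_mul_actV _ _ _

theorem mulW_mul_actT (f : Laurent N) (n : ℤ) (B : gl m) :
    mulW m V f * actT m N V n B = actT m N V n B * mulW m V f := mulW_mul_actV _ _

variable (m V) in
/-- The action of `∑ E_ab ⊗ E_ba t^n` on the `p`-th factor `ℂ^m` and on `V`. -/
def casimirW (p : Fin N) (n : ℤ) : Module.End ℂ (WSpace m N V) :=
  ∑ a, ∑ b, siteW m V p (Matrix.single a b 1) * actT m N V n (Matrix.single b a 1)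

variable (m V) in
/-- The action of `∑ E_ab ⊗ [E_ba, A] t^n` on the `p`-th factor `ℂ^m` and on `V`. -/
def casimirLieW (p : Fin N) (n : ℤ) (A : gl m) : Module.End ℂ (WSpace m N V) :=
  ∑ a, ∑ b, siteW m V p (Matrix.single a b 1) *
    actT m N V n (Matrix.single b a 1 * A - A * Matrix.single b a 1)

theorem mulW_mul_casimirW (f : Laurent N) (p : Fin N) (n : ℤ) :
    mulW m V f * casimirW m V p n = casimirW m V p n * mulW m V f := by
  simp only [casimirW, Finset.mul_sum, Finset.sum_mul]
  refine Finset.sum_congr rfl fun a _ => Finset.sum_congr rfl fun b _ => ?_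
  rw [← mul_assoc, mulW_mul_siteW, mul_assoc, mulW_mul_actT, mul_assoc]

theorem permTW_mul_casimirW (σ : Equiv.Perm (Fin N)) (p : Fin N) (n : ℤ) :
    permTW m V σ * casimirW m V p n = casimirW m V (σ p) n * permTW m V σ := by
  simp only [casimirW, Finset.mul_sum, Finset.sum_mul]
  refine Finset.sum_congr rfl fun a _ => Finset.sum_congr rfl fun b _ => ?_
  rw [← mul_assoc, permTW_mul_siteW, mul_assoc, actT_apply, permTW_mul_actV, mul_assoc]

theorem permLW_mul_casimirW (σ : Equiv.Perm (Fin N)) (p : Fin N) (n : ℤ) :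
    permLW m V σ * casimirW m V p n = casimirW m V p n * permLW m V σ := by
  simp only [casimirW, Finset.mul_sum, Finset.sum_mul]
  refine Finset.sum_congr rfl fun a _ => Finset.sum_congr rfl fun b _ => ?_
  rw [← mul_assoc, permLW_mul_siteW, mul_assoc, actT_apply, permLW_mul_actV, mul_assoc]

theorem opPerm_mul_casimirW (σ : Equiv.Perm (Fin N)) (p : Fin N) (n : ℤ) :
    opPerm m N V σ * casimirW m V p n = casimirW m V (σ p) n * opPerm m N V σ := by
  rw [opPerm_eq, mul_assoc, permTW_mul_casimirW, ← mul_assoc, permLW_mul_casimirW, mul_assoc]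

/-- The current part of the Casimir commutator. -/
theorem casimirW_mul_actT (p : Fin N) (i k : ℤ) (A : sl m) :
    casimirW m V p i * actT m N V k A = actT m N V k A * casimirW m V p i +
      casimirLieW m V p (i + k) A +
      (if i = -k then (i : ℂ) else 0) • (siteW m V p A * actV m N V (slC m)) := by
  have h : ∀ a b, siteW m V p (Matrix.single a b 1) * actT m N V i (Matrix.single b a 1) *
      actT m N V k A =
      actT m N V k A * (siteW m V p (Matrix.single a b 1) * actT m N V i (Matrix.single b a 1)) +
      siteW m V p (Matrix.single a b 1) *
        actT m N V (i + k) (Matrix.single b a 1 * (A : gl m) - (A : gl m) * Matrix.single b a 1) +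
      (if i = -k then (i : ℂ) else 0) •
        ((Matrix.single b a 1 * (A : gl m)).trace • siteW m V p (Matrix.single a b 1) *
          actV m N V (slC m)) := by
    intro a b
    rw [mul_assoc, actT_mul_actT, toSl_coe, trace_toSl_mul, mul_add, mul_add, ← mul_assoc,
      siteW_mul_actT, mul_assoc]
    congr 1
    split_ifs
    · rw [mul_smul_comm, mul_smul, smul_mul_assoc]
    · rw [zero_smul, zero_smul, mul_zero]
  simp only [casimirW, casimirLieW, Finset.sum_mul, h, Finset.sum_add_distrib, Finset.mul_sum]
  congr 1
  -- The central terms carry the scalars tr(E_ba A), which contract the sum of the E_ab^{(p)} to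
  -- A^{(p)}.
  rw [← sum_trace_single_mul (siteW m V p) A]
  simp only [Finset.sum_mul, Finset.smul_sum]

/-- Invariance of the Casimir tensor under ad A: the commutator on the site is transferred to the
leg acting on V. -/
theorem casimirW_mul_siteW_same (p : Fin N) (n : ℤ) (A : gl m) :
    casimirW m V p n * siteW m V p A + casimirLieW m V p n A =
      siteW m V p A * casimirW m V p n := by
  have h1 : casimirW m V p n * siteW m V p A = ∑ a, ∑ b,
      siteW m V p (Matrix.single a b 1) * actT m N V n (A * Matrix.single b a 1) := by
    rw [← sum_single_mul]
    simp only [casimirW, Finset.sum_mul, mul_assoc, ← siteW_mul_actT, siteW_mul]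
  have h2 : siteW m V p A * casimirW m V p n = ∑ a, ∑ b,
      siteW m V p (Matrix.single a b 1) * actT m N V n (Matrix.single b a 1 * A) := by
    rw [← sum_mul_single]
    simp only [casimirW, Finset.mul_sum, mul_assoc, siteW_mul]
  rw [h1, h2, casimirLieW]
  simp only [← Finset.sum_add_distrib, ← mul_add, ← map_add]
  simp

theorem casimirW_mul_siteW_of_ne {p q : Fin N} (h : p ≠ q) (n : ℤ) (A : gl m) :
    casimirW m V p n * siteW m V q A = siteW m V q A * casimirW m V p n := by
  simp only [casimirW, Finset.mul_sum, Finset.sum_mul]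
  refine Finset.sum_congr rfl fun a _ => Finset.sum_congr rfl fun b _ => ?_
  rw [mul_assoc, ← siteW_mul_actT, ← mul_assoc, siteW_comm h, mul_assoc]

theorem casimirW_mul_currentW (p : Fin N) (i k : ℤ) (A : gl m) :
    casimirW m V p i * currentW m V k A + mulW m V (xPow p k) * casimirLieW m V p i A =
      currentW m V k A * casimirW m V p i := by
  have h : ∀ q ∈ Finset.univ.erase p,
      casimirW m V p i * (mulW m V (xPow q k) * siteW m V q A) =
        mulW m V (xPow q k) * siteW m V q A * casimirW m V p i := by
    intro q hq
    rw [← mul_assoc, ← mulW_mul_casimirW, mul_assoc,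
      casimirW_mul_siteW_of_ne (Finset.ne_of_mem_erase hq).symm, mul_assoc]
  rw [currentW, Finset.mul_sum, Finset.sum_mul, ← Finset.add_sum_erase _ _ (Finset.mem_univ p),
    Finset.sum_congr rfl h, ← Finset.add_sum_erase Finset.univ _ (Finset.mem_univ p), mul_assoc,
    ← casimirW_mul_siteW_same, mul_add, ← mul_assoc (casimirW _ _ _ _), ← mulW_mul_casimirW]
  simp only [mul_assoc]
  abel

theorem sum_pairs_comm {M ι : Type*} [AddCommMonoid M] [Fintype ι] (f : ι → ι → ι → ι → M) :
    ∑ a, ∑ b, ∑ c, ∑ d, f a b c d = ∑ c, ∑ d, ∑ a, ∑ b, f a b c d := by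
  calc _ = ∑ a, ∑ c, ∑ d, ∑ b, f a b c d := by
        refine Finset.sum_congr rfl fun a _ => ?_
        rw [Finset.sum_comm]
        exact Finset.sum_congr rfl fun c _ => Finset.sum_comm
    _ = _ := by
        rw [Finset.sum_comm]
        exact Finset.sum_congr rfl fun c _ => Finset.sum_comm

theorem casimirTerm_mul_casimirTerm {p q : Fin N} (h : p ≠ q) (i j : ℕ) (A B C D : gl m) :
    siteW m V p A * actT m N V i B * (siteW m V q C * actT m N V j D) =
      siteW m V q C * actT m N V j D * (siteW m V p A * actT m N V i B) +
      (siteW m V q C * (siteW m V p A * actT m N V (i + j) (B * D)) -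
      siteW m V p A * (siteW m V q C * actT m N V (i + j) (D * B))) := by
  -- For i, j ≥ 0 the cocycle can contribute only at i = j = 0, where its coefficient i is zero;
  -- hence no level enters the commutation of the Z_p.
  have h0 : (if (i : ℤ) = -(j : ℤ) then
      ((i : ℤ) : ℂ) * ((toSl m B : gl m) * (toSl m D : gl m)).trace else 0) = 0 := by
    split_ifs with hij
    · have : i = 0 := by omega
      simp [this]
    · rfl
  have e := actT_mul_actT (N := N) (V := V) (i : ℤ) j B D
  rw [h0, zero_smul, add_zero, map_sub] at e
  rw [mul_assoc (siteW m V p A), ← mul_assoc (actT m N V i B), ← siteW_mul_actT,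
    mul_assoc (siteW m V q C), e, mul_assoc (siteW m V q C), ← mul_assoc (actT m N V j D),
    ← siteW_mul_actT, ← mul_assoc (siteW m V p A), siteW_comm h, ← mul_assoc (siteW m V p A),
    siteW_comm h]
  noncomm_ring

/-- A form of the classical Yang-Baxter equation. Products E_ba E_dc arise on the V leg; invariance
moves one factor to a site, where the matrix units of the two sites sum to the flip. -/
theorem casimirW_mul_casimirW {p q : Fin N} (h : p ≠ q) (i j : ℕ) :
    casimirW m V p i * casimirW m V q j = casimirW m V q j * casimirW m V p i +
      permTW m V (Equiv.swap p q) * (casimirW m V p (i + j) - casimirW m V q (i + j)) := by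
  have e1 : ∑ a, ∑ b, ∑ c, ∑ d, siteW m V q (Matrix.single c d 1) *
      (siteW m V p (Matrix.single a b 1) *
        actT m N V (i + j) (Matrix.single b a 1 * Matrix.single d c 1)) =
      permTW m V (Equiv.swap p q) * casimirW m V p (i + j) := by
    have : ∀ c d, ∑ a, ∑ b, siteW m V p (Matrix.single a b 1) *
        actT m N V (i + j) (Matrix.single b a 1 * Matrix.single d c 1) =
        siteW m V p (Matrix.single d c 1) * casimirW m V p (i + j) := by
      intro c d
      rw [← sum_mul_single]
      simp only [casimirW, Finset.mul_sum, mul_assoc, siteW_mul]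
    rw [permTW_swap h, Finset.sum_mul, sum_pairs_comm]
    simp only [Finset.sum_mul]
    simp only [← Finset.mul_sum, this]
    rw [Finset.sum_comm]
    simp only [← mul_assoc, siteW_comm h.symm]
  have e2 : ∑ a, ∑ b, ∑ c, ∑ d, siteW m V p (Matrix.single a b 1) *
      (siteW m V q (Matrix.single c d 1) *
        actT m N V (i + j) (Matrix.single d c 1 * Matrix.single b a 1)) =
      permTW m V (Equiv.swap p q) * casimirW m V q (i + j) := by
    have : ∀ a b, ∑ c, ∑ d, siteW m V q (Matrix.single c d 1) *
        actT m N V (i + j) (Matrix.single d c 1 * Matrix.single b a 1) =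
        siteW m V q (Matrix.single b a 1) * casimirW m V q (i + j) := by
      intro a b
      rw [← sum_mul_single]
      simp only [casimirW, Finset.mul_sum, mul_assoc, siteW_mul]
    rw [permTW_swap h, Finset.sum_mul]
    simp only [← Finset.mul_sum, this, Finset.sum_mul, mul_assoc]
  have e3 : casimirW m V p i * casimirW m V q j = ∑ a, ∑ b, ∑ c, ∑ d,
      siteW m V p (Matrix.single a b 1) * actT m N V i (Matrix.single b a 1) *
        (siteW m V q (Matrix.single c d 1) * actT m N V j (Matrix.single d c 1)) := by
    simp only [casimirW, Finset.sum_mul]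
    simp only [Finset.mul_sum]
  have e4 : casimirW m V q j * casimirW m V p i = ∑ a, ∑ b, ∑ c, ∑ d,
      siteW m V q (Matrix.single c d 1) * actT m N V j (Matrix.single d c 1) *
        (siteW m V p (Matrix.single a b 1) * actT m N V i (Matrix.single b a 1)) := by
    simp only [casimirW, Finset.mul_sum]
    simp only [Finset.sum_mul]
  rw [mul_sub, ← e1, ← e2, e3, e4]
  simp only [casimirTerm_mul_casimirTerm h, Finset.sum_add_distrib, Finset.sum_sub_distrib]

theorem opGapTerm_eq (p : Fin N) (i : ℕ) :
    opGapTerm m N V p i = mulW m V (xPow p (-(i : ℤ))) * casimirW m V p i := by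
  have : ∀ a b, mulW m V (xPow p (-(i : ℤ))) * (siteW m V p (Matrix.single a b 1) *
      actT m N V i (Matrix.single b a 1)) = tensorOp m V (LinearMap.mulLeft ℂ (xPow p (-(i : ℤ))))
        (site m p (Matrix.single a b 1))
        (LieModule.toEnd ℂ (slHat m) V (slT m i (toSl m (Matrix.single b a 1)))) := by
    intro a b
    change tensorOp m V _ _ _ * (tensorOp m V _ _ _ * tensorOp m V _ _ _) = _
    simp only [tensorOp_mul, mul_one, one_mul]
    rfl
  simp only [casimirW, Finset.mul_sum, this]
  rfl

end Gap

section Constants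

variable {m N : ℕ} {V : Type*} [AddCommGroup V] [Module ℂ V]

/-! ### Operators commuting with Laurent polynomials -/

/-- The operator `∑_{r ≠ p} x_p (x_p - x_r)⁻¹ (1 - σ_pr)(f) σ_pr` for `f = x_q ^ j` with `q ≠ p`. -/
theorem sum_divDiff_xPow {p q : Fin N} (h : q ≠ p) (j : ℤ) :
    ∑ r ∈ Finset.univ.erase p,
        mulW m V (xPow p 1 * divDiff p r (xPow q j)) * opPerm m N V (Equiv.swap p r) =
      -(mulW m V (xPow p 1 * divDiff p q (xPow p j)) * opPerm m N V (Equiv.swap p q)) := by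
  rw [Finset.sum_eq_single q]
  · rw [divDiff_xPow_right h.symm, mul_neg, map_neg, neg_mul]
  · intro r hr hrq
    rw [divDiff_xPow_of_ne (Finset.ne_of_mem_erase hr).symm h hrq.symm, mul_zero, map_zero,
      zero_mul]
  · simp [h]

variable (m N V) in
/-- The subspace `1 ⊗ (ℂ^m)^{⊗N} ⊗ V` of `W`. -/
def constW : Submodule ℂ (WSpace m N V) :=
  LinearMap.range (TensorProduct.map (TensorProduct.mk ℂ (Laurent N) (Tens m N) 1)
    (LinearMap.id : V →ₗ[ℂ] V))

theorem tmul_mem_constW (t : Tens m N) (v : V) :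
    ((1 : Laurent N) ⊗ₜ[ℂ] t) ⊗ₜ[ℂ] v ∈ constW m N V := ⟨t ⊗ₜ v, rfl⟩

theorem apply_eq_of_mem_constW {F G : Module.End ℂ (WSpace m N V)}
    (h : ∀ t v, F (((1 : Laurent N) ⊗ₜ[ℂ] t) ⊗ₜ[ℂ] v) = G (((1 : Laurent N) ⊗ₜ[ℂ] t) ⊗ₜ[ℂ] v))
    {w : WSpace m N V} (hw : w ∈ constW m N V) : F w = G w := by
  obtain ⟨u, rfl⟩ := hw
  induction u using TensorProduct.induction_on with
  | zero => simp
  | add a b ha hb => simp only [map_add, ha, hb]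
  | tmul t v => exact h t v

/-- W is generated as a module over the Laurent polynomials by its constants. -/
theorem eq_of_commute_mulW {F G : Module.End ℂ (WSpace m N V)}
    (hF : ∀ f, F * mulW m V f = mulW m V f * F) (hG : ∀ f, G * mulW m V f = mulW m V f * G)
    (h : ∀ w ∈ constW m N V, F w = G w) : F = G := by
  refine TensorProduct.ext' fun a v => ?_
  induction a using TensorProduct.induction_on with
  | zero => simp
  | add a b ha hb => rw [TensorProduct.add_tmul, map_add, map_add, ha, hb]
  | tmul f t =>
    have e : (f ⊗ₜ[ℂ] t) ⊗ₜ[ℂ] v = mulW m V f (((1 : Laurent N) ⊗ₜ[ℂ] t) ⊗ₜ[ℂ] v) := by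
      change _ = ((f * 1) ⊗ₜ[ℂ] t) ⊗ₜ[ℂ] v
      rw [mul_one]
    rw [e, ← Module.End.mul_apply, ← Module.End.mul_apply, hF, hG, Module.End.mul_apply,
      Module.End.mul_apply, h _ (tmul_mem_constW t v)]

/-- Commuting with an invertible operator implies commuting with its inverse, and the x_p with their
inverses generate the Laurent ring. -/
theorem commute_mulW_of_commute_xPow {F : Module.End ℂ (WSpace m N V)}
    (hF : ∀ p, F * mulW m V (xPow p 1) = mulW m V (xPow p 1) * F) (f : Laurent N) :
    F * mulW m V f = mulW m V f * F := by
  have hmul : ∀ f g : Laurent N, Commute F (mulW m V f) → Commute F (mulW m V g) →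
      Commute F (mulW m V (f * g)) := fun f g hf hg => by
    rw [map_mul]; exact hf.mul_right hg
  have hneg : ∀ p, Commute F (mulW m V (xPow p (-1))) := by
    intro p
    have h1 : mulW m V (xPow p (-1)) * mulW m V (xPow p 1) = 1 := by
      rw [← map_mul, xPow_mul, neg_add_cancel, xPow_zero, map_one]
    have h2 : mulW m V (xPow p 1) * mulW m V (xPow p (-1)) = 1 := by
      rw [← map_mul, xPow_mul, add_neg_cancel, xPow_zero, map_one]
    calc F * mulW m V (xPow p (-1)) = mulW m V (xPow p (-1)) * mulW m V (xPow p 1) * F *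
          mulW m V (xPow p (-1)) := by rw [h1, one_mul]
      _ = mulW m V (xPow p (-1)) * F := by
          rw [mul_assoc (mulW m V (xPow p (-1))), ← hF, mul_assoc, mul_assoc, h2, mul_one]
  have hx : ∀ (q : Fin N) (j : ℤ), Commute F (mulW m V (xPow q j)) := by
    intro q j
    induction j using Int.induction_on with
    | zero => rw [xPow_zero, map_one]; exact Commute.one_right F
    | succ i ih => rw [← xPow_mul]; exact hmul _ _ ih (hF q)
    | pred i ih => rw [sub_eq_add_neg (-(i : ℤ)), ← xPow_mul]; exact hmul _ _ ih (hneg q)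
  have hmon : ∀ e : Fin N → ℤ, Commute F (mulW m V (AddMonoidAlgebra.single e 1)) := by
    intro e
    induction e using Pi.single_induction with
    | zero => rw [← AddMonoidAlgebra.one_def, map_one]; exact Commute.one_right F
    | add e e' h h' =>
      have : (AddMonoidAlgebra.single (e + e') 1 : Laurent N) =
        AddMonoidAlgebra.single e 1 * AddMonoidAlgebra.single e' 1 := by
        simp [AddMonoidAlgebra.single_mul_single]
      rw [this]
      exact hmul _ _ h h'
    | single q j => exact hx q j
  induction f using AddMonoidAlgebra.induction_on with
  | of e => exact hmon _
  | add f g hf hg => rw [map_add, mul_add, add_mul, hf, hg]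
  | smul c f hf => rw [map_smul, mul_smul_comm, smul_mul_assoc, hf]

theorem permLW_apply_of_mem_constW (σ : Equiv.Perm (Fin N)) {w : WSpace m N V}
    (hw : w ∈ constW m N V) : permLW m V σ w = w := by
  refine apply_eq_of_mem_constW (G := 1) (fun t v => ?_) hw
  change ((permL σ 1) ⊗ₜ[ℂ] t) ⊗ₜ[ℂ] v = _
  rw [map_one]
  rfl

theorem opPerm_apply_of_mem_constW (σ : Equiv.Perm (Fin N)) {w : WSpace m N V}
    (hw : w ∈ constW m N V) : opPerm m N V σ w = permTW m V σ w := by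
  rw [opPerm_eq, permLW_mul_permTW, Module.End.mul_apply, permLW_apply_of_mem_constW σ hw]

theorem opDunkl_apply_of_mem_constW (κ : ℂ) (p : Fin N) {w : WSpace m N V}
    (hw : w ∈ constW m N V) : opDunkl m N V κ p w = 0 := by
  refine apply_eq_of_mem_constW (G := 0) (fun t v => ?_) hw
  rw [opDunkl_eq, LinearMap.add_apply, LinearMap.smul_apply, LinearMap.sum_apply]
  have h1 : eulerW m V p (((1 : Laurent N) ⊗ₜ[ℂ] t) ⊗ₜ[ℂ] v) = 0 := by
    change ((xPow p 1 * partialL p 1) ⊗ₜ[ℂ] t) ⊗ₜ[ℂ] v = 0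
    rw [AddMonoidAlgebra.one_def, partialL_single]
    simp
  have h2 : ∀ r ∈ Finset.univ.erase p, (divDiffW m V p r * permTW m V (Equiv.swap p r))
      (((1 : Laurent N) ⊗ₜ[ℂ] t) ⊗ₜ[ℂ] v) = 0 := by
    intro r hr
    change ((xPow p 1 * divDiff p r 1) ⊗ₜ[ℂ] permT m (Equiv.swap p r) t) ⊗ₜ[ℂ] v = 0
    rw [divDiff_one (Finset.ne_of_mem_erase hr).symm, mul_zero, TensorProduct.zero_tmul,
      TensorProduct.zero_tmul]
  rw [h1, smul_zero, Finset.sum_eq_zero h2, add_zero]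
  rfl

/-- The sum `∑_{a < n} x_p ^ (-a) x_q ^ (a - n)`. -/
def homSum (p q : Fin N) (n : ℕ) : Laurent N :=
  ∑ a ∈ Finset.range n, xPow p (-(a : ℤ)) * xPow q ((a : ℤ) - n)

/-- Since the Dunkl operator kills constants, only its commutator with x_q^{-n} remains. There only
the index r = q contributes, and on constants the simultaneous swap is the swap of factors. -/
theorem opDunkl_apply_xPow_of_mem_constW (κ : ℂ) {p q : Fin N} (h : q ≠ p) (n : ℕ)
    {w : WSpace m N V} (hw : w ∈ constW m N V) :
    opDunkl m N V κ p (mulW m V (xPow q (-(n : ℤ))) w) =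
      mulW m V (homSum p q n) (permTW m V (Equiv.swap p q) w) := by
  rw [← Module.End.mul_apply, opDunkl_mul_mulW, xPow_mul_partialL_xPow, if_neg h, map_zero,
    smul_zero, add_zero, sum_divDiff_xPow h, xPow_mul_divDiff_xPow_neg h.symm, map_neg, neg_mul,
    neg_neg, LinearMap.add_apply, Module.End.mul_apply, opDunkl_apply_of_mem_constW κ p hw,
    map_zero, zero_add, Module.End.mul_apply, opPerm_apply_of_mem_constW _ hw]
  rfl

/-- `homSum p q n` is the full antidiagonal sum without its endpoint a = n. The version
`sum_antidiagonal_eq_right` omits the opposite endpoint; the mismatch of these endpoints yields the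
right-hand side of the commutator. -/
theorem sum_antidiagonal_eq_left (p q : Fin N) (n : ℕ) :
    ∑ a ∈ Finset.range (n + 1), (xPow p (-(a : ℤ)) * xPow q (-((n - a : ℕ) : ℤ)) : Laurent N) =
      homSum p q n + xPow p (-(n : ℤ)) := by
  rw [Finset.sum_range_succ, Nat.sub_self, Nat.cast_zero, neg_zero, xPow_zero, mul_one, homSum]
  congr 1
  refine Finset.sum_congr rfl fun a ha => ?_
  rw [Nat.cast_sub (Finset.mem_range.1 ha).le, neg_sub]

theorem sum_antidiagonal_eq_right (p q : Fin N) (n : ℕ) :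
    ∑ a ∈ Finset.range (n + 1), (xPow p (-(a : ℤ)) * xPow q (-((n - a : ℕ) : ℤ)) : Laurent N) =
      homSum q p n + xPow q (-(n : ℤ)) := by
  rw [← sum_antidiagonal_eq_left, ← Finset.sum_range_reflect]
  refine Finset.sum_congr rfl fun a ha => ?_
  have := Finset.mem_range.1 ha
  rw [show n + 1 - 1 - a = n - a by omega, show n - (n - a) = a by omega, mul_comm]

/-- A square sum whose terms vanish from total degree n onwards reduces to a triangle, grouped here
by total degree. -/
theorem sum_range_sum_range_eq {M : Type*} [AddCommMonoid M] (n : ℕ) (f : ℕ → ℕ → M)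
    (h : ∀ j i, n ≤ i + j → f j i = 0) :
    ∑ j ∈ Finset.range n, ∑ i ∈ Finset.range n, f j i =
      ∑ k ∈ Finset.range n, ∑ j ∈ Finset.range (k + 1), f j (k - j) := by
  rw [Finset.sum_range_diag_flip]
  refine Finset.sum_congr rfl fun j _ => (Finset.sum_subset ?_ fun i _ hi => h j i ?_).symm
  · exact Finset.range_mono (Nat.sub_le n j)
  · have : ¬ i < n - j := fun h' => hi (Finset.mem_range.2 h')
    omega

end Constants

section Cherednik

variable {m N : ℕ} {V : Type*} [AddCommGroup V] [Module ℂ V]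
  [LieRingModule (slHat m) V] [LieModule ℂ (slHat m) V]

/-! ### The infinite sum -/

theorem opGap_apply (hV : IsSmooth m V) (p : Fin N) (w : WSpace m N V) :
    opGap N hV p w = ∑ᶠ i : ℕ, opGapTerm m N V p i w := rfl

theorem opGap_eq_sum (hV : IsSmooth m V) (p : Fin N) {w : WSpace m N V} {M : ℕ}
    (h : ∀ i ≥ M, opGapTerm m N V p i w = 0) :
    opGap N hV p w = ∑ i ∈ Finset.range M, opGapTerm m N V p i w := by
  rw [opGap_apply]
  refine finsum_eq_sum_of_support_subset _ fun i hi => ?_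
  by_contra h'
  exact hi (h i (by simpa using h'))

theorem eventually_opGapTerm_eq_zero (hV : IsSmooth m V) (p : Fin N) (w : WSpace m N V) :
    ∀ᶠ M in Filter.atTop, ∀ i ≥ M, opGapTerm m N V p i w = 0 := by
  obtain ⟨n, hn⟩ := (opGapTerm_finite N hV p w).bddAbove
  refine Filter.eventually_atTop.2 ⟨n + 1, fun M hM i hi => ?_⟩
  by_contra h
  have := hn h
  omega

/-- Multiplication by x_p^{-i} is invertible, so the Casimir factor vanishes together with the
corresponding term of the sum. -/
theorem eventually_casimirW_eq_zero (hV : IsSmooth m V) (p : Fin N) (w : WSpace m N V) :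
    ∀ᶠ M : ℕ in Filter.atTop, ∀ i ≥ M, casimirW m V p i w = 0 := by
  filter_upwards [eventually_opGapTerm_eq_zero hV p w] with M hM i hi
  have h := congrArg (mulW m V (xPow p (i : ℤ))) (hM i hi)
  rwa [opGapTerm_eq, map_zero, ← Module.End.mul_apply, ← mul_assoc, ← map_mul, xPow_mul,
    add_neg_cancel, xPow_zero, map_one, one_mul] at h

/-- Intertwining each term suffices because the sum is finite on each vector. The map and the sites
are kept general to cover multiplications, permutations and functoriality at once. -/
theorem map_opGap {V' : Type*} [AddCommGroup V'] [Module ℂ V'] [LieRingModule (slHat m) V']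
    [LieModule ℂ (slHat m) V'] (hV : IsSmooth m V) (hV' : IsSmooth m V') (p q : Fin N)
    (F : WSpace m N V →ₗ[ℂ] WSpace m N V')
    (h : ∀ i w, F (opGapTerm m N V p i w) = opGapTerm m N V' q i (F w)) (w : WSpace m N V) :
    F (opGap N hV p w) = opGap N hV' q (F w) := by
  rw [opGap_apply, opGap_apply, ← finsum_congr fun i => h i w]
  exact AddMonoidHom.map_finsum F.toAddMonoidHom (opGapTerm_finite N hV p w)

theorem mulW_mul_opGap (hV : IsSmooth m V) (f : Laurent N) (p : Fin N) :
    mulW m V f * opGap N hV p = opGap N hV p * mulW m V f := by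
  refine LinearMap.ext fun w => map_opGap hV hV p p (mulW m V f) (fun i w => ?_) w
  rw [opGapTerm_eq, ← Module.End.mul_apply, ← Module.End.mul_apply, ← mul_assoc, ← map_mul,
    mul_comm f, map_mul, mul_assoc, mulW_mul_casimirW, mul_assoc]

theorem opPerm_mul_opGap (hV : IsSmooth m V) (σ : Equiv.Perm (Fin N)) (p : Fin N) :
    opPerm m N V σ * opGap N hV p = opGap N hV (σ p) * opPerm m N V σ := by
  refine LinearMap.ext fun w => map_opGap hV hV p (σ p) (opPerm m N V σ) (fun i w => ?_) w
  rw [opGapTerm_eq, opGapTerm_eq, ← Module.End.mul_apply, ← Module.End.mul_apply, ← mul_assoc,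
    opPerm_mul_mulW, mul_assoc, opPerm_mul_casimirW, permL_xPow, mul_assoc]

/-! ### The cross relations for the Cherednik operators -/

theorem opCherednik_mul_mulW (hV : IsSmooth m V) (κ : ℂ) (p : Fin N) (f : Laurent N) :
    opCherednik N hV κ p * mulW m V f = mulW m V f * opCherednik N hV κ p +
      κ • mulW m V (xPow p 1 * partialL p f) +
      ∑ r ∈ Finset.univ.erase p,
        mulW m V (xPow p 1 * divDiff p r f) * opPerm m N V (Equiv.swap p r) := by
  rw [opCherednik, add_mul, mul_add, opDunkl_mul_mulW, mulW_mul_opGap]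
  abel

theorem opPerm_mul_opCherednik (hV : IsSmooth m V) (κ : ℂ) (σ : Equiv.Perm (Fin N)) (p : Fin N) :
    opPerm m N V σ * opCherednik N hV κ p = opCherednik N hV κ (σ p) * opPerm m N V σ := by
  rw [opCherednik, opCherednik, add_mul, mul_add, opPerm_mul_opDunkl, opPerm_mul_opGap]

theorem opCherednik_mul_xPow_same (hV : IsSmooth m V) (κ : ℂ) (p : Fin N) :
    opCherednik N hV κ p * mulW m V (xPow p 1) =
      mulW m V (xPow p 1) * opCherednik N hV κ p + κ • mulW m V (xPow p 1) +
        ∑ r ∈ Finset.univ.erase p, mulW m V (xPow p 1) * opPerm m N V (Equiv.swap p r) := by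
  rw [opCherednik_mul_mulW, xPow_mul_partialL_xPow, if_pos rfl, Int.cast_one, one_smul]
  congr 1
  refine Finset.sum_congr rfl fun r hr => ?_
  rw [divDiff_xPow_left (Finset.ne_of_mem_erase hr).symm, mul_one]

theorem opCherednik_mul_xPow_of_ne (hV : IsSmooth m V) (κ : ℂ) {p q : Fin N} (h : q ≠ p) :
    opCherednik N hV κ p * mulW m V (xPow q 1) =
      mulW m V (xPow q 1) * opCherednik N hV κ p -
        mulW m V (xPow p 1) * opPerm m N V (Equiv.swap p q) := by
  rw [opCherednik_mul_mulW, xPow_mul_partialL_xPow, if_neg h, map_zero, smul_zero, add_zero,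
    sum_divDiff_xPow h, divDiff_xPow_left h.symm, mul_one, sub_eq_add_neg]

/-! ### Commutators of the Cherednik operators -/

theorem casimirW_mem_constW (p : Fin N) (n : ℤ) {w : WSpace m N V} (hw : w ∈ constW m N V) :
    casimirW m V p n w ∈ constW m N V := by
  obtain ⟨u, rfl⟩ := hw
  induction u using TensorProduct.induction_on with
  | zero => simp
  | add a b ha hb => simp only [map_add]; exact add_mem ha hb
  | tmul t v =>
    simp only [casimirW, LinearMap.sum_apply, Module.End.mul_apply]
    refine sum_mem fun a _ => sum_mem fun b _ => ?_
    exact tmul_mem_constW (site m p (Matrix.single a b 1) t)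
      ⁅slT m n (toSl m (Matrix.single b a 1)), v⁆

/-- The commutator of the infinite sums in the Cherednik operators, on `1 ⊗ (ℂ^m)^{⊗N} ⊗ V`. -/
theorem opCherednik_apply_opCherednik_apply (hV : IsSmooth m V) (κ : ℂ) {p q : Fin N} (h : q ≠ p)
    {w : WSpace m N V} (hw : w ∈ constW m N V) :
    ∀ᶠ M in Filter.atTop, opCherednik N hV κ p (opCherednik N hV κ q w) =
      ∑ i ∈ Finset.range M, mulW m V (homSum p q i)
        (permTW m V (Equiv.swap p q) (casimirW m V q i w)) +
      ∑ j ∈ Finset.range M, ∑ i ∈ Finset.range M,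
        mulW m V (xPow p (-(j : ℤ)) * xPow q (-(i : ℤ)))
          ((casimirW m V p j * casimirW m V q i) w) := by
  filter_upwards [eventually_opGapTerm_eq_zero hV q w,
    eventually_opGapTerm_eq_zero hV p (opGap N hV q w)] with M h1 h2
  have e1 : opCherednik N hV κ q w = opGap N hV q w := by
    rw [opCherednik, LinearMap.add_apply, opDunkl_apply_of_mem_constW κ q hw, zero_add]
  rw [e1, opCherednik, LinearMap.add_apply, opGap_eq_sum hV p h2, opGap_eq_sum hV q h1]
  congr 1
  · rw [map_sum]
    refine Finset.sum_congr rfl fun i _ => ?_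
    rw [opGapTerm_eq, Module.End.mul_apply,
      opDunkl_apply_xPow_of_mem_constW κ h i (casimirW_mem_constW q i hw)]
  · refine Finset.sum_congr rfl fun j _ => ?_
    rw [map_sum]
    refine Finset.sum_congr rfl fun i _ => ?_
    rw [← Module.End.mul_apply, ← Module.End.mul_apply, opGapTerm_eq, opGapTerm_eq, mul_assoc,
      ← mul_assoc (casimirW m V p j), ← mulW_mul_casimirW, map_mul]
    simp only [mul_assoc]

/-- On constants κ drops out, and after a common truncation the identity becomes one between finite
sums graded by the power of t acting on V. -/
theorem opCherednik_commutator_apply (hV : IsSmooth m V) (κ : ℂ) {p q : Fin N} (h : p ≠ q)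
    {w : WSpace m N V} (hw : w ∈ constW m N V) :
    opCherednik N hV κ p (opCherednik N hV κ q w) - opCherednik N hV κ q (opCherednik N hV κ p w) =
      opPerm m N V (Equiv.swap p q) (opCherednik N hV κ p w - opCherednik N hV κ q w) := by
  obtain ⟨M, h1, h2, h3, h4, h5, h6⟩ :=
    ((opCherednik_apply_opCherednik_apply hV κ h.symm hw).and
      ((opCherednik_apply_opCherednik_apply hV κ h hw).and
        ((eventually_opGapTerm_eq_zero hV p w).and
          ((eventually_opGapTerm_eq_zero hV q w).and
            ((eventually_casimirW_eq_zero hV p w).and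
              (eventually_casimirW_eq_zero hV q w)))))).exists
  set P := permTW m V (Equiv.swap p q) with hP
  have e0 : ∀ r, opCherednik N hV κ r w = opGap N hV r w := by
    intro r
    rw [opCherednik, LinearMap.add_apply, opDunkl_apply_of_mem_constW κ r hw, zero_add]
  have e1 : ∀ i : ℕ, opPerm m N V (Equiv.swap p q) (opGapTerm m N V p i w) =
      mulW m V (xPow q (-(i : ℤ))) (P (casimirW m V p i w)) := by
    intro i
    rw [opGapTerm_eq, ← Module.End.mul_apply, ← mul_assoc, opPerm_mul_mulW, permL_xPow,
      Equiv.swap_apply_left, Module.End.mul_apply, Module.End.mul_apply,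
      opPerm_apply_of_mem_constW _ (casimirW_mem_constW p i hw)]
  have e2 : ∀ i : ℕ, opPerm m N V (Equiv.swap p q) (opGapTerm m N V q i w) =
      mulW m V (xPow p (-(i : ℤ))) (P (casimirW m V q i w)) := by
    intro i
    rw [opGapTerm_eq, ← Module.End.mul_apply, ← mul_assoc, opPerm_mul_mulW, permL_xPow,
      Equiv.swap_apply_right, Module.End.mul_apply, Module.End.mul_apply,
      opPerm_apply_of_mem_constW _ (casimirW_mem_constW q i hw)]
  -- The Casimir operators are reordered; the commutators depend on i and j only through i + j, so
  -- their coefficients collect into antidiagonal sums.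
  have e3 : ∑ j ∈ Finset.range M, ∑ i ∈ Finset.range M,
        mulW m V (xPow p (-(j : ℤ)) * xPow q (-(i : ℤ)))
          ((casimirW m V p j * casimirW m V q i) w) =
      ∑ j ∈ Finset.range M, ∑ i ∈ Finset.range M,
        mulW m V (xPow q (-(j : ℤ)) * xPow p (-(i : ℤ)))
          ((casimirW m V q j * casimirW m V p i) w) +
      ∑ n ∈ Finset.range M, mulW m V (∑ a ∈ Finset.range (n + 1),
        xPow p (-(a : ℤ)) * xPow q (-((n - a : ℕ) : ℤ)))
          (P (casimirW m V p n w - casimirW m V q n w)) := by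
    rw [Finset.sum_comm (f := fun j i : ℕ => mulW m V (xPow q (-(j : ℤ)) * xPow p (-(i : ℤ)))
          ((casimirW m V q j * casimirW m V p i) w))]
    have e : ∑ n ∈ Finset.range M, mulW m V (∑ a ∈ Finset.range (n + 1),
        xPow p (-(a : ℤ)) * xPow q (-((n - a : ℕ) : ℤ)))
          (P (casimirW m V p n w - casimirW m V q n w)) =
        ∑ j ∈ Finset.range M, ∑ i ∈ Finset.range M,
          mulW m V (xPow p (-(j : ℤ)) * xPow q (-(i : ℤ)))
            (P (casimirW m V p ((j + i : ℕ) : ℤ) w - casimirW m V q ((j + i : ℕ) : ℤ) w)) := by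
      rw [sum_range_sum_range_eq]
      · refine Finset.sum_congr rfl fun n _ => ?_
        rw [map_sum, LinearMap.sum_apply]
        refine Finset.sum_congr rfl fun a ha => ?_
        rw [Nat.add_sub_of_le (Nat.lt_succ_iff.1 (Finset.mem_range.1 ha))]
      · intro j i hij
        rw [h5 _ (by omega), h6 _ (by omega), sub_zero, map_zero, map_zero]
    rw [e, ← Finset.sum_add_distrib]
    refine Finset.sum_congr rfl fun j _ => ?_
    rw [← Finset.sum_add_distrib]
    refine Finset.sum_congr rfl fun i _ => ?_
    rw [mul_comm (xPow q _) (xPow p _), ← map_add, casimirW_mul_casimirW h, LinearMap.add_apply,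
      Module.End.mul_apply (permTW m V (Equiv.swap p q)), LinearMap.sub_apply, Nat.cast_add]
  -- In each degree the antidiagonal sum cancels both geometric sums from the Dunkl part, written
  -- with one endpoint split off for Ω_p and with the other for Ω_q. Only the endpoints survive.
  have e4 : ∀ n, mulW m V (homSum p q n) (P (casimirW m V q n w)) -
      mulW m V (homSum q p n) (P (casimirW m V p n w)) +
      mulW m V (∑ a ∈ Finset.range (n + 1),
        xPow p (-(a : ℤ)) * xPow q (-((n - a : ℕ) : ℤ)))
          (P (casimirW m V p n w - casimirW m V q n w)) =
      mulW m V (xPow q (-(n : ℤ))) (P (casimirW m V p n w)) -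
        mulW m V (xPow p (-(n : ℤ))) (P (casimirW m V q n w)) := by
    intro n
    rw [map_sub P, map_sub (mulW m V _)]
    nth_rewrite 1 [sum_antidiagonal_eq_right]
    rw [sum_antidiagonal_eq_left, map_add (mulW m V), map_add (mulW m V), LinearMap.add_apply,
      LinearMap.add_apply]
    abel
  rw [Equiv.swap_comm q p, ← hP] at h2
  rw [h1, h2, e0, e0, opGap_eq_sum hV p h3, opGap_eq_sum hV q h4, map_sub, map_sum, map_sum,
    Finset.sum_congr rfl fun i _ => e1 i, Finset.sum_congr rfl fun i _ => e2 i, e3,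
    ← Finset.sum_sub_distrib, ← Finset.sum_congr rfl fun n _ => e4 n, Finset.sum_add_distrib,
    Finset.sum_sub_distrib]
  abel

theorem opCherednik_commutator (hV : IsSmooth m V) (κ : ℂ) {p q : Fin N} (h : p ≠ q) :
    opCherednik N hV κ p * opCherednik N hV κ q - opCherednik N hV κ q * opCherednik N hV κ p =
      (opCherednik N hV κ q - opCherednik N hV κ p) * opPerm m N V (Equiv.swap p q) := by
  rw [← sub_eq_zero]
  have hx : ∀ r, _ := fun r => commute_defect_of_cross_relations (κ := κ)
    (Z := opCherednik N hV κ) (X := fun p => mulW m V (xPow p 1)) (S := opPerm m N V)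
    opPerm_mul opPerm_one (fun σ p => by rw [opPerm_mul_mulW, permL_xPow])
    (opPerm_mul_opCherednik hV κ) (fun p q h => opCherednik_mul_xPow_of_ne hV κ h)
    (opCherednik_mul_xPow_same hV κ) h r
  refine eq_of_commute_mulW (commute_mulW_of_commute_xPow hx) (fun f => ?_) fun w hw => ?_
  · rw [zero_mul, mul_zero]
  · have e : (opCherednik N hV κ q - opCherednik N hV κ p) * opPerm m N V (Equiv.swap p q) =
        opPerm m N V (Equiv.swap p q) * (opCherednik N hV κ p - opCherednik N hV κ q) := by
      rw [mul_sub, sub_mul, opPerm_mul_opCherednik, opPerm_mul_opCherednik, Equiv.swap_apply_left,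
        Equiv.swap_apply_right]
    rw [e, LinearMap.sub_apply, LinearMap.sub_apply, Module.End.mul_apply, Module.End.mul_apply,
      opCherednik_commutator_apply hV κ h hw, Module.End.mul_apply, LinearMap.sub_apply, sub_self]
    rfl

end Cherednik

/-! ### Contractions of the Casimir tensor with the currents on the tensor factors. -/

section CurrentAction

variable {m N : ℕ} {V : Type*} [AddCommGroup V] [Module ℂ V]

theorem mulW_mul_currentW (f : Laurent N) (j : ℤ) (A : gl m) :
    mulW m V f * currentW m V j A = currentW m V j A * mulW m V f := by
  rw [currentW, Finset.mul_sum, Finset.sum_mul]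
  refine Finset.sum_congr rfl fun q _ => ?_
  rw [← mul_assoc, ← map_mul, mul_comm f, map_mul, mul_assoc, mulW_mul_siteW, mul_assoc]

/-- On a single site, the sum of E_ba A E_ab is the scalar tr A = 0, while that of A E_ba E_ab is m
A. -/
theorem sum_lie_single_mul_siteW (p : Fin N) (A : sl m) :
    ∑ a, ∑ b, siteW m V p (Matrix.single b a 1 * (A : gl m) - (A : gl m) * Matrix.single b a 1) *
      siteW m V p (Matrix.single a b 1) = -((m : ℂ) • siteW m V p A) := by
  have hA : (A : gl m).trace = 0 := A.2
  have e := sum_single_mul_mul_single (A : gl m)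
  rw [hA, zero_smul] at e
  have e' : ∑ a, ∑ b, ((A : gl m) * (Matrix.single b a 1 * Matrix.single a b 1) : gl m) =
      (m : ℂ) • (A : gl m) := by
    simp only [← Finset.mul_sum, sum_single_mul_single]
    rw [mul_smul_comm, mul_one]
  simp only [← siteW_mul, sub_mul, ← map_sum, Finset.sum_sub_distrib, e]
  simp only [mul_assoc, e', zero_sub, map_neg, map_smul]

/-- On two different sites the Casimir tensor is the flip, and a matrix moved through the flip
changes site. -/
theorem sum_lie_single_mul_siteW_of_ne {p r : Fin N} (h : p ≠ r) (A : gl m) :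
    ∑ a, ∑ b, siteW m V r (Matrix.single b a 1 * A - A * Matrix.single b a 1) *
      siteW m V p (Matrix.single a b 1) =
      (siteW m V p A - siteW m V r A) * permTW m V (Equiv.swap p r) := by
  have e1 : ∑ a, ∑ b, siteW m V r (Matrix.single b a 1 * A) * siteW m V p (Matrix.single a b 1) =
      siteW m V p A * permTW m V (Equiv.swap p r) := by
    have : siteW m V p A * permTW m V (Equiv.swap p r) =
        permTW m V (Equiv.swap p r) * siteW m V r A := by
      rw [permTW_mul_siteW, Equiv.swap_apply_right]
    rw [this, permTW_swap h]
    simp only [Finset.sum_mul, siteW_comm h.symm, ← siteW_mul, mul_assoc]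
  have e2 : ∑ a, ∑ b, siteW m V r (A * Matrix.single b a 1) * siteW m V p (Matrix.single a b 1) =
      siteW m V r A * permTW m V (Equiv.swap p r) := by
    rw [permTW_swap h]
    simp only [Finset.mul_sum, siteW_mul, mul_assoc, siteW_comm h]
  simp only [map_sub, sub_mul, Finset.sum_sub_distrib, e1, e2]

theorem sum_currentW_lie_single_mul_siteW (p : Fin N) (n : ℤ) (A : sl m) :
    ∑ a, ∑ b, currentW m V n
      (Matrix.single b a 1 * (A : gl m) - (A : gl m) * Matrix.single b a 1) *
        siteW m V p (Matrix.single a b 1) =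
      -((m : ℂ) • (mulW m V (xPow p n) * siteW m V p A)) +
      ∑ r ∈ Finset.univ.erase p, mulW m V (xPow r n) *
        ((siteW m V p A - siteW m V r A) * permTW m V (Equiv.swap p r)) := by
  have e : ∑ a, ∑ b, currentW m V n
      (Matrix.single b a 1 * (A : gl m) - (A : gl m) * Matrix.single b a 1) *
        siteW m V p (Matrix.single a b 1) = ∑ q : Fin N, mulW m V (xPow q n) *
          (∑ a : Fin m, ∑ b : Fin m, siteW m V q
            (Matrix.single b a 1 * (A : gl m) - (A : gl m) * Matrix.single b a 1) *
              siteW m V p (Matrix.single a b 1)) := by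
    simp only [currentW, Finset.sum_mul, Finset.mul_sum, mul_assoc]
    rw [Finset.sum_comm (s := Finset.univ (α := Fin N))]
    exact Finset.sum_congr rfl fun a _ => Finset.sum_comm
  rw [e, ← Finset.add_sum_erase _ _ (Finset.mem_univ p), sum_lie_single_mul_siteW, mul_neg,
    mul_smul_comm]
  congr 1
  refine Finset.sum_congr rfl fun r hr => ?_
  rw [sum_lie_single_mul_siteW_of_ne (Finset.ne_of_mem_erase hr).symm]

end CurrentAction

section Currents

variable {m N : ℕ} {V : Type*} [AddCommGroup V] [Module ℂ V]
  [LieRingModule (slHat m) V] [LieModule ℂ (slHat m) V]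

/-! ### The Cherednik operators and the action of `ŝl_m` -/

theorem slAct_slT_eq (j : ℤ) (A : sl m) :
    slAct m N V (slT m j A) = currentW m V j A + actT m N V j A := by
  rw [slAct_slT, currentW, actT_coe]
  have h : ∀ q : Fin N, mulW m V (xPow q j) * siteW m V q (A : gl m) =
      tensorOp m V (LinearMap.mulLeft ℂ (xPow q j)) (site m q A) 1 := by
    intro q
    change tensorOp m V _ _ _ * tensorOp m V _ _ _ = _
    rw [tensorOp_mul, mul_one, one_mul, mul_one]
  simp only [h]
  congr 1
  refine TensorProduct.ext' fun a v => ?_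
  rw [actV_tmul]
  rfl

theorem mulW_mul_slAct (f : Laurent N) (j : ℤ) (A : sl m) :
    mulW m V f * slAct m N V (slT m j A) = slAct m N V (slT m j A) * mulW m V f := by
  rw [slAct_slT_eq, mul_add, add_mul, mulW_mul_currentW, mulW_mul_actT]

theorem opPerm_mul_slAct (σ : Equiv.Perm (Fin N)) (j : ℤ) (A : sl m) :
    opPerm m N V σ * slAct m N V (slT m j A) = slAct m N V (slT m j A) * opPerm m N V σ := by
  rw [slAct_slT_eq, mul_add, add_mul, opPerm_mul_currentW]
  congr 1
  rw [actT_apply, opPerm_eq, mul_assoc, permTW_mul_actV, ← mul_assoc, permLW_mul_actV, mul_assoc]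

/-- By invariance this operator is a commutator of A^{(p)} with the Casimir operator, so smoothness
at `w` and at A^{(p)} `w` suffices. -/
theorem eventually_casimirLieW_eq_zero (hV : IsSmooth m V) (p : Fin N) (A : gl m)
    (w : WSpace m N V) :
    ∀ᶠ M : ℕ in Filter.atTop, ∀ i ≥ M, casimirLieW m V p i A w = 0 := by
  filter_upwards [eventually_casimirW_eq_zero hV p w,
    eventually_casimirW_eq_zero hV p (siteW m V p A w)] with M h1 h2 i hi
  have h := LinearMap.congr_fun (casimirW_mul_siteW_same (V := V) p (i : ℤ) A) w
  rwa [LinearMap.add_apply, Module.End.mul_apply, Module.End.mul_apply, h1 i hi, h2 i hi, map_zero,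
    zero_add] at h

/-- The corrections from the site p and from V have the same shape, with i shifted by k, which makes
the sum over i telescope. -/
theorem opGapTerm_mul_slAct (p : Fin N) (i : ℕ) (k : ℤ) (A : sl m) :
    opGapTerm m N V p i * slAct m N V (slT m k A) +
        mulW m V (xPow p (-(i : ℤ) + k)) * casimirLieW m V p i A =
      slAct m N V (slT m k A) * opGapTerm m N V p i +
        mulW m V (xPow p (-(i : ℤ))) * casimirLieW m V p (i + k) A +
        (if (i : ℤ) = -k then (i : ℂ) else 0) •
          (mulW m V (xPow p (-(i : ℤ))) * (siteW m V p A * actV m N V (slC m))) := by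
  have h1 := casimirW_mul_currentW (V := V) p i k (A : gl m)
  have h2 := casimirW_mul_actT (V := V) p i k A
  rw [opGapTerm_eq, ← xPow_mul, map_mul, mul_assoc, mul_assoc, ← mul_add, ← mul_assoc (slAct _ _ _ _),
    ← mulW_mul_slAct, mul_assoc, ← mul_smul_comm, ← mul_add, ← mul_add]
  congr 1
  rw [slAct_slT_eq, mul_add, add_mul, h2, ← h1, Int.cast_natCast]
  abel

theorem opDunkl_mul_slAct (κ : ℂ) (p : Fin N) (j : ℤ) (A : sl m) :
    opDunkl m N V κ p * slAct m N V (slT m j A) = slAct m N V (slT m j A) * opDunkl m N V κ p +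
      (κ * j) • (mulW m V (xPow p j) * siteW m V p A) +
      ∑ r ∈ Finset.univ.erase p, mulW m V (xPow p 1 * divDiff p r (xPow p j)) *
        (siteW m V r A - siteW m V p A) * permTW m V (Equiv.swap p r) := by
  have h : opDunkl m N V κ p * actT m N V j A = actT m N V j A * opDunkl m N V κ p := by
    rw [opDunkl_eq, actT_apply, add_mul, mul_add, smul_mul_assoc, mul_smul_comm, eulerW_mul_actV,
      Finset.sum_mul, Finset.mul_sum]
    congr 1
    refine Finset.sum_congr rfl fun r _ => ?_
    rw [mul_assoc, permTW_mul_actV, ← mul_assoc, divDiffW_mul_actV, mul_assoc]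
  rw [slAct_slT_eq, mul_add, add_mul, opDunkl_mul_currentW, h]
  abel

/-- For k = -j the two series of corrections coincide after a shift by j, leaving the first j terms
of one of them; the cocycle contributes only at i = j. -/
theorem opGap_mul_slAct (hV : IsSmooth m V) (p : Fin N) (j : ℕ) (A : sl m) :
    opGap N hV p * slAct m N V (slT m (-(j : ℤ)) A) =
      slAct m N V (slT m (-(j : ℤ)) A) * opGap N hV p +
        ∑ i ∈ Finset.range j,
          mulW m V (xPow p (-(i : ℤ))) * casimirLieW m V p ((i : ℤ) - j) A +
        (j : ℂ) • (mulW m V (xPow p (-(j : ℤ))) * (siteW m V p A * actV m N V (slC m))) := by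
  refine LinearMap.ext fun w => ?_
  obtain ⟨M, h1, h2, h3⟩ := ((eventually_opGapTerm_eq_zero hV p w).and
    ((eventually_opGapTerm_eq_zero hV p (slAct m N V (slT m (-(j : ℤ)) A) w)).and
      (eventually_casimirLieW_eq_zero hV p A w))).exists
  -- The cutoff j + (M + 1) splits as j initial terms and a shifted block that still contains all
  -- nonzero terms; the extra 1 keeps the index i = j in range for the central term.
  have hM : M ≤ j + (M + 1) := by omega
  have e1 := opGap_eq_sum hV p fun i (hi : i ≥ j + (M + 1)) => h1 i (by omega)
  have e2 := opGap_eq_sum hV p fun i (hi : i ≥ j + (M + 1)) => h2 i (by omega)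
  have e3 : ∑ i ∈ Finset.range (j + (M + 1)),
      (mulW m V (xPow p (-(i : ℤ))) * casimirLieW m V p ((i : ℤ) - j) A) w =
      ∑ i ∈ Finset.range j,
        (mulW m V (xPow p (-(i : ℤ))) * casimirLieW m V p ((i : ℤ) - j) A) w +
      ∑ i ∈ Finset.range (j + (M + 1)),
        (mulW m V (xPow p (-(i : ℤ) + -(j : ℤ))) * casimirLieW m V p i A) w := by
    rw [Finset.sum_range_add]
    congr 1
    have hsub : Finset.range (M + 1) ⊆ Finset.range (j + (M + 1)) :=
      Finset.range_mono (by omega)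
    rw [← Finset.sum_subset hsub]
    · refine Finset.sum_congr rfl fun i _ => ?_
      rw [show -((j + i : ℕ) : ℤ) = -(i : ℤ) + -(j : ℤ) by push_cast; ring,
        show ((j + i : ℕ) : ℤ) - j = i by push_cast; ring]
    · intro i _ hi
      rw [Finset.mem_range] at hi
      rw [Module.End.mul_apply, h3 i (by omega), map_zero]
  have e4 : ∑ i ∈ Finset.range (j + (M + 1)), ((if (i : ℤ) = -(-(j : ℤ)) then (i : ℂ) else 0) •
          (mulW m V (xPow p (-(i : ℤ))) * (siteW m V p A * actV m N V (slC m)))) w =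
      ((j : ℂ) • (mulW m V (xPow p (-(j : ℤ))) * (siteW m V p A * actV m N V (slC m)))) w := by
    rw [Finset.sum_eq_single j]
    · rw [neg_neg, if_pos rfl]
    · intro i _ hi
      rw [if_neg (by omega), zero_smul, LinearMap.zero_apply]
    · intro hj
      exact absurd (Finset.mem_range.2 (by omega)) hj
  have e5 : ∀ i, opGapTerm m N V p i (slAct m N V (slT m (-(j : ℤ)) A) w) =
      slAct m N V (slT m (-(j : ℤ)) A) (opGapTerm m N V p i w) +
        (mulW m V (xPow p (-(i : ℤ))) * casimirLieW m V p ((i : ℤ) - j) A) w +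
        ((if (i : ℤ) = -(-(j : ℤ)) then (i : ℂ) else 0) •
          (mulW m V (xPow p (-(i : ℤ))) * (siteW m V p A * actV m N V (slC m)))) w -
        (mulW m V (xPow p (-(i : ℤ) + -(j : ℤ))) * casimirLieW m V p i A) w := by
    intro i
    have h := LinearMap.congr_fun (opGapTerm_mul_slAct (V := V) p i (-(j : ℤ)) A) w
    rw [LinearMap.add_apply, LinearMap.add_apply, LinearMap.add_apply] at h
    exact eq_sub_of_add_eq h
  rw [Module.End.mul_apply, e2, LinearMap.add_apply, LinearMap.add_apply, LinearMap.sum_apply,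
    Module.End.mul_apply, e1, map_sum, Finset.sum_congr rfl fun i _ => e5 i,
    Finset.sum_sub_distrib, Finset.sum_add_distrib, Finset.sum_add_distrib, e3, e4]
  abel

/-- The commutator of a Cherednik operator with the action of `A t^(-j)`, for `j ≥ 0`. -/
theorem opCherednik_mul_slAct (hV : IsSmooth m V) (κ : ℂ) (p : Fin N) (j : ℕ) (A : sl m) :
    opCherednik N hV κ p * slAct m N V (slT m (-(j : ℤ)) A) =
      slAct m N V (slT m (-(j : ℤ)) A) * opCherednik N hV κ p -
        (κ * j) • (mulW m V (xPow p (-(j : ℤ))) * siteW m V p A) +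
        ∑ r ∈ Finset.univ.erase p, mulW m V (homSum p r j) *
          (siteW m V p A - siteW m V r A) * permTW m V (Equiv.swap p r) +
        ∑ i ∈ Finset.range j,
          mulW m V (xPow p (-(i : ℤ))) * casimirLieW m V p ((i : ℤ) - j) A +
        (j : ℂ) • (mulW m V (xPow p (-(j : ℤ))) * (siteW m V p A * actV m N V (slC m))) := by
  have h : ∑ r ∈ Finset.univ.erase p, mulW m V (xPow p 1 * divDiff p r (xPow p (-(j : ℤ)))) *
        (siteW m V r A - siteW m V p A) * permTW m V (Equiv.swap p r) =
      ∑ r ∈ Finset.univ.erase p, mulW m V (homSum p r j) *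
        (siteW m V p A - siteW m V r A) * permTW m V (Equiv.swap p r) := by
    refine Finset.sum_congr rfl fun r hr => ?_
    rw [xPow_mul_divDiff_xPow_neg (Finset.ne_of_mem_erase hr).symm, map_neg, neg_mul,
      ← mul_neg, neg_sub]
    rfl
  rw [opCherednik, add_mul, mul_add, opDunkl_mul_slAct, opGap_mul_slAct, h, Int.cast_neg,
    Int.cast_natCast, mul_neg, neg_smul]
  abel

theorem opCherednik_mul_slAct_zero (hV : IsSmooth m V) (κ : ℂ) (p : Fin N) (A : sl m) :
    opCherednik N hV κ p * slAct m N V (slT m 0 A) =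
      slAct m N V (slT m 0 A) * opCherednik N hV κ p := by
  have h := opCherednik_mul_slAct hV κ p 0 A
  simpa [homSum] using h

/-- The operators `∑ E_ab ⊗ [E_ba, A] t^n`, in terms of the action of `ŝl_m` on `W`. -/
theorem casimirLieW_eq (p : Fin N) (n : ℤ) (A : sl m) :
    casimirLieW m V p n A =
      ∑ a, ∑ b, slAct m N V (slT m n
        (toSl m (Matrix.single b a 1 * (A : gl m) - (A : gl m) * Matrix.single b a 1))) *
          siteW m V p (Matrix.single a b 1) +
      (m : ℂ) • (mulW m V (xPow p n) * siteW m V p A) -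
      ∑ r ∈ Finset.univ.erase p, mulW m V (xPow r n) *
        ((siteW m V p A - siteW m V r A) * permTW m V (Equiv.swap p r)) := by
  have hcoe : ∀ B : gl m, (toSl m (B * (A : gl m) - (A : gl m) * B) : gl m) =
      B * (A : gl m) - (A : gl m) * B := by
    intro B
    rw [coe_toSl, Matrix.trace_sub, Matrix.trace_mul_comm, sub_self, zero_div, zero_smul, sub_zero]
  have e := sum_currentW_lie_single_mul_siteW (V := V) p n A
  have e' : casimirLieW m V p n A = ∑ a, ∑ b, actT m N V n
      (Matrix.single b a 1 * (A : gl m) - (A : gl m) * Matrix.single b a 1) *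
        siteW m V p (Matrix.single a b 1) := by
    simp only [casimirLieW, siteW_mul_actT]
  simp only [slAct_slT_eq, hcoe, add_mul, Finset.sum_add_distrib, e, ← e']
  abel

theorem slAct_mem_qW {n : ℤ} (hn : n < 0) (A : sl m) (w : WSpace m N V) :
    slAct m N V (slT m n A) w ∈ qW m N V :=
  Submodule.subset_span ⟨_, Submodule.subset_span ⟨n, hn, A, rfl⟩, w, rfl⟩

/-- The algebra q is spanned by the A t^{-j} with j > 0, and membership of the image is linear in
the current. -/
theorem map_qW_le {F : Module.End ℂ (WSpace m N V)}
    (h : ∀ (j : ℕ) (A : sl m) (w : WSpace m N V), 0 < j →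
      F (slAct m N V (slT m (-(j : ℤ)) A) w) ∈ qW m N V) {w : WSpace m N V}
    (hw : w ∈ qW m N V) : F w ∈ qW m N V := by
  have hle : qW m N V ≤ (qW m N V).comap F := by
    refine Submodule.span_le.2 ?_
    rintro _ ⟨X, hX, w', rfl⟩
    change F _ ∈ qW m N V
    induction hX using Submodule.span_induction with
    | mem X hX =>
      obtain ⟨j, hj, A, rfl⟩ := hX
      have e : j = -((-j).toNat : ℤ) := by omega
      rw [e]
      exact h _ A w' (by omega)
    | zero => rw [map_zero, LinearMap.zero_apply, map_zero]; exact zero_mem _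
    | add X Y _ _ hX hY => rw [map_add, LinearMap.add_apply, map_add]; exact add_mem hX hY
    | smul c X _ hX =>
      rw [map_smul, LinearMap.smul_apply, map_smul]; exact Submodule.smul_mem _ _ hX
  exact hle hw

theorem actV_slC_of_hasLevel {ℓ : ℂ} (h : HasLevel m V ℓ) :
    actV m N V (slC m) = ℓ • (1 : Module.End ℂ (WSpace m N V)) := by
  refine TensorProduct.ext' fun a v => ?_
  rw [actV_tmul, h v, TensorProduct.tmul_smul]
  rfl

/-- All powers t^{i-j} left by the telescoping are negative, so rewriting them through the action on
W lands in q W; the level is tuned to kill what is left. -/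
theorem opCherednik_mem_qW (hV : IsSmooth m V) (κ : ℂ) (hℓ : HasLevel m V (κ - m)) (p : Fin N)
    {w : WSpace m N V} (hw : w ∈ qW m N V) : opCherednik N hV κ p w ∈ qW m N V := by
  refine map_qW_le (fun j A w hj => ?_) hw
  have e1 : ∑ i ∈ Finset.range j,
      mulW m V (xPow p (-(i : ℤ))) * casimirLieW m V p ((i : ℤ) - j) A =
      ∑ i ∈ Finset.range j, ∑ a, ∑ b, slAct m N V (slT m ((i : ℤ) - j)
        (toSl m (Matrix.single b a 1 * (A : gl m) - (A : gl m) * Matrix.single b a 1))) *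
          (mulW m V (xPow p (-(i : ℤ))) * siteW m V p (Matrix.single a b 1)) +
      (j * m : ℂ) • (mulW m V (xPow p (-(j : ℤ))) * siteW m V p A) -
      ∑ r ∈ Finset.univ.erase p, mulW m V (homSum p r j) *
        (siteW m V p A - siteW m V r A) * permTW m V (Equiv.swap p r) := by
    have : ∀ i ∈ Finset.range j,
        mulW m V (xPow p (-(i : ℤ))) * casimirLieW m V p ((i : ℤ) - j) A =
        ∑ a, ∑ b, slAct m N V (slT m ((i : ℤ) - j)
          (toSl m (Matrix.single b a 1 * (A : gl m) - (A : gl m) * Matrix.single b a 1))) *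
            (mulW m V (xPow p (-(i : ℤ))) * siteW m V p (Matrix.single a b 1)) +
        (m : ℂ) • (mulW m V (xPow p (-(j : ℤ))) * siteW m V p A) -
        ∑ r ∈ Finset.univ.erase p, mulW m V (xPow p (-(i : ℤ)) * xPow r ((i : ℤ) - j)) *
          (siteW m V p A - siteW m V r A) * permTW m V (Equiv.swap p r) := by
      intro i _
      rw [casimirLieW_eq, mul_sub, mul_add, mul_smul_comm, ← mul_assoc (mulW m V _) (mulW m V _),
        ← map_mul, xPow_mul, show -(i : ℤ) + (i - j) = -j by ring]
      simp only [Finset.mul_sum, ← mul_assoc, mulW_mul_slAct, map_mul]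
    rw [Finset.sum_congr rfl this, Finset.sum_sub_distrib, Finset.sum_add_distrib, Finset.sum_const,
      Finset.card_range, ← Nat.cast_smul_eq_nsmul ℂ, smul_smul, Finset.sum_comm (t := Finset.univ.erase p)]
    simp only [homSum, map_sum, Finset.sum_mul]
  rw [← Module.End.mul_apply, opCherednik_mul_slAct, e1, actV_slC_of_hasLevel hℓ]
  -- Here `b` stands for x_p^{-j} A^{(p)}, with total coefficient -κ j + j m + j (κ - m) = 0, and
  -- `c` for the exchange terms, which occur with both signs.
  have e3 : ∀ (x b c d : Module.End ℂ (WSpace m N V)),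
      x - (κ * j) • b + c + (d + (j * m : ℂ) • b - c) + (j : ℂ) • ((κ - m) • b) = x + d := by
    intro x b c d
    module
  rw [mul_smul_comm, mul_one, mul_smul_comm, e3, LinearMap.add_apply]
  refine add_mem (slAct_mem_qW (by omega) A _) ?_
  simp only [LinearMap.sum_apply, Module.End.mul_apply]
  refine sum_mem fun i hi => sum_mem fun a _ => sum_mem fun b _ => slAct_mem_qW ?_ _ _
  have := Finset.mem_range.1 hi
  omega

end Currents

/-! ### The action of the trigonometric Cherednik algebra -/

section Action

variable {m N : ℕ} {V : Type*} [AddCommGroup V] [Module ℂ V]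

variable (m V) in
/-- The sum of the transpositions `σ_rp` with `r < p`, as an operator on `W`. -/
def jucysMurphyW (p : Fin N) : Module.End ℂ (WSpace m N V) :=
  ∑ r ∈ Finset.Iio p, opPerm m N V (Equiv.swap r p)

/-- Conjugation by σ merely permutes the transpositions in the sum. -/
theorem opPerm_mul_jucysMurphyW {σ : Equiv.Perm (Fin N)} {q : Fin N} (hσ : σ q = q)
    (h : ∀ r, σ r < q ↔ r < q) :
    opPerm m N V σ * jucysMurphyW m V q = jucysMurphyW m V q * opPerm m N V σ := by
  rw [jucysMurphyW, Finset.mul_sum, Finset.sum_mul]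
  refine Finset.sum_bijective σ σ.bijective (fun r => ?_) fun r _ => ?_
  · rw [Finset.mem_Iio, Finset.mem_Iio, h]
  · rw [← opPerm_mul, ← opPerm_mul, Equiv.mul_swap_eq_swap_mul, hσ]

theorem swap_apply_lt_iff {a b q : Fin N} (h : a < q ↔ b < q) (r : Fin N) :
    Equiv.swap a b r < q ↔ r < q := by
  rcases eq_or_ne r a with rfl | ha
  · rw [Equiv.swap_apply_left, h]
  rcases eq_or_ne r b with rfl | hb
  · rw [Equiv.swap_apply_right, h]
  · rw [Equiv.swap_apply_of_ne_of_ne ha hb]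

variable [LieRingModule (slHat m) V] [LieModule ℂ (slHat m) V]

variable (N) in
/-- The operator on `W` by which `u_p` acts. -/
def opU (hV : IsSmooth m V) (κ : ℂ) (p : Fin N) : Module.End ℂ (WSpace m N V) :=
  opCherednik N hV κ p + jucysMurphyW m V p

theorem opPerm_swap_mul_opU (hV : IsSmooth m V) (κ : ℂ) {a b q : Fin N} (ha : q ≠ a) (hb : q ≠ b)
    (h : a < q ↔ b < q) :
    opPerm m N V (Equiv.swap a b) * opU N hV κ q =
      opU N hV κ q * opPerm m N V (Equiv.swap a b) := by
  have hq : Equiv.swap a b q = q := Equiv.swap_apply_of_ne_of_ne ha hb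
  rw [opU, mul_add, add_mul, opPerm_mul_opCherednik, hq,
    opPerm_mul_jucysMurphyW hq (swap_apply_lt_iff h)]

/-- For p < q, u_q commutes with every transposition in the sum for u_p. It remains that Z_p
commutes with Z_q plus the transpositions in u_q. -/
theorem opU_comm (hV : IsSmooth m V) (κ : ℂ) (p q : Fin N) :
    opU N hV κ p * opU N hV κ q = opU N hV κ q * opU N hV κ p := by
  suffices h : ∀ p q : Fin N, p < q →
      opU N hV κ p * opU N hV κ q = opU N hV κ q * opU N hV κ p by
    rcases lt_trichotomy p q with hpq | rfl | hpq
    · exact h p q hpq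
    · rfl
    · exact (h q p hpq).symm
  intro p q hpq
  have e1 : jucysMurphyW m V p * opU N hV κ q = opU N hV κ q * jucysMurphyW m V p := by
    rw [jucysMurphyW, Finset.sum_mul, Finset.mul_sum]
    refine Finset.sum_congr rfl fun r hr => ?_
    have hr : r < q := (Finset.mem_Iio.1 hr).trans hpq
    exact opPerm_swap_mul_opU hV κ hr.ne' hpq.ne' (by simp [hr, hpq])
  -- Among the transpositions σ_rq with r < q only r = p moves the index p; its commutator with Z_p
  -- is opposite to the defect of [Z_p, Z_q].
  have e2 : jucysMurphyW m V q * opCherednik N hV κ p + opCherednik N hV κ p *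
      opPerm m N V (Equiv.swap p q) = opCherednik N hV κ p * jucysMurphyW m V q +
        opCherednik N hV κ q * opPerm m N V (Equiv.swap p q) := by
    have hp : p ∈ Finset.Iio q := Finset.mem_Iio.2 hpq
    have e : ∀ r ∈ (Finset.Iio q).erase p, opPerm m N V (Equiv.swap r q) * opCherednik N hV κ p =
        opCherednik N hV κ p * opPerm m N V (Equiv.swap r q) := by
      intro r hr
      rw [opPerm_mul_opCherednik,
        Equiv.swap_apply_of_ne_of_ne (Finset.ne_of_mem_erase hr).symm hpq.ne]
    rw [jucysMurphyW, Finset.sum_mul, Finset.mul_sum, ← Finset.add_sum_erase _ _ hp,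
      ← Finset.add_sum_erase (Finset.Iio q) (fun i => opCherednik N hV κ p * _) hp,
      Finset.sum_congr rfl e, opPerm_mul_opCherednik, Equiv.swap_apply_left]
    abel
  have e3 := opCherednik_commutator hV κ hpq.ne
  have e4 : opU N hV κ p * opU N hV κ q = opCherednik N hV κ p * opCherednik N hV κ q +
      opCherednik N hV κ p * jucysMurphyW m V q + jucysMurphyW m V p * opU N hV κ q := by
    simp only [opU, add_mul, mul_add]
    abel
  have e5 : opU N hV κ q * opU N hV κ p = opCherednik N hV κ q * opCherednik N hV κ p +
      jucysMurphyW m V q * opCherednik N hV κ p + opU N hV κ q * jucysMurphyW m V p := by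
    simp only [opU, add_mul, mul_add]
  rw [sub_mul] at e3
  rw [e4, e5, e1, eq_sub_of_add_eq e2, eq_add_of_sub_eq e3]
  abel

/-- Conjugation matches all transpositions except σ_pp', present only for the larger index; its
square accounts for the constant 1. -/
theorem opPerm_swap_mul_opU_succ (hV : IsSmooth m V) (κ : ℂ) {p p' : Fin N}
    (hp : (p' : ℕ) = p + 1) :
    opPerm m N V (Equiv.swap p p') * opU N hV κ p =
      opU N hV κ p' * opPerm m N V (Equiv.swap p p') - 1 := by
  have hlt : p < p' := Fin.lt_def.2 (by omega)
  have hI : Finset.Iio p' = insert p (Finset.Iio p) := by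
    ext r
    simp only [Finset.mem_Iio, Finset.mem_insert, Fin.lt_def, Fin.ext_iff]
    omega
  have hsq : opPerm m N V (Equiv.swap p p') * opPerm m N V (Equiv.swap p p') = 1 := by
    rw [← opPerm_mul, Equiv.swap_mul_self, opPerm_one]
  have e : ∀ r ∈ Finset.Iio p, opPerm m N V (Equiv.swap p p') * opPerm m N V (Equiv.swap r p) =
      opPerm m N V (Equiv.swap r p') * opPerm m N V (Equiv.swap p p') := by
    intro r hr
    have hr : r < p := Finset.mem_Iio.1 hr
    rw [← opPerm_mul, ← opPerm_mul, Equiv.mul_swap_eq_swap_mul, Equiv.swap_apply_left,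
      Equiv.swap_apply_of_ne_of_ne hr.ne (hr.trans hlt).ne]
  rw [opU, opU, mul_add, add_mul, opPerm_mul_opCherednik, Equiv.swap_apply_left, jucysMurphyW,
    jucysMurphyW, hI, Finset.sum_insert (by simp), add_mul, hsq, Finset.mul_sum,
    Finset.sum_congr rfl e, Finset.sum_mul]
  abel

variable (N) in
/-- The operators on `W` by which the generators of the Cherednik algebra act. -/
def genAct (hV : IsSmooth m V) (κ : ℂ) : Gen N → Module.End ℂ (WSpace m N V)
  | Gen.x p => opX m N V p 1
  | Gen.xinv p => opX m N V p (-1)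
  | Gen.s σ => opPerm m N V σ
  | Gen.u p => opU N hV κ p

variable (N) in
/-- The action of the free algebra on `W`. -/
def freeAct (hV : IsSmooth m V) (κ : ℂ) : FreeGen N →ₐ[ℂ] Module.End ℂ (WSpace m N V) :=
  FreeAlgebra.lift ℂ (genAct N hV κ)

variable (hV : IsSmooth m V) (κ : ℂ)

theorem freeAct_x (p : Fin N) : freeAct N hV κ (FreeGen.x p) = mulW m V (xPow p 1) := by
  rw [freeAct, FreeGen.x, FreeAlgebra.lift_ι_apply]; rfl

theorem freeAct_xinv (p : Fin N) : freeAct N hV κ (FreeGen.xinv p) = mulW m V (xPow p (-1)) := by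
  rw [freeAct, FreeGen.xinv, FreeAlgebra.lift_ι_apply]; rfl

theorem freeAct_s (σ : Equiv.Perm (Fin N)) :
    freeAct N hV κ (FreeGen.s σ) = opPerm m N V σ := by
  rw [freeAct, FreeGen.s, FreeAlgebra.lift_ι_apply]; rfl

theorem freeAct_u (p : Fin N) : freeAct N hV κ (FreeGen.u p) = opU N hV κ p := by
  rw [freeAct, FreeGen.u, FreeAlgebra.lift_ι_apply]; rfl

theorem freeAct_z (p : Fin N) : freeAct N hV κ (FreeGen.z p) = opCherednik N hV κ p := by
  rw [FreeGen.z, map_sub, map_sum, freeAct_u, Finset.sum_congr rfl fun r _ => freeAct_s hV κ _,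
    opU, jucysMurphyW]
  exact add_sub_cancel_right _ _

theorem freeAct_rel {a b : FreeGen N} (h : Rel κ N a b) : freeAct N hV κ a = freeAct N hV κ b := by
  cases h with
  | s_one => rw [freeAct_s, opPerm_one, map_one]
  | s_mul σ τ => rw [map_mul, freeAct_s, freeAct_s, freeAct_s, opPerm_mul]
  | x_comm p q => rw [map_mul, map_mul, freeAct_x, freeAct_x, ← map_mul, ← map_mul, mul_comm]
  | x_xinv p =>
    rw [map_mul, freeAct_x, freeAct_xinv, ← map_mul, xPow_mul, add_neg_cancel, xPow_zero, map_one,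
      map_one]
  | xinv_x p =>
    rw [map_mul, freeAct_x, freeAct_xinv, ← map_mul, xPow_mul, neg_add_cancel, xPow_zero, map_one,
      map_one]
  | u_comm p q => rw [map_mul, map_mul, freeAct_u, freeAct_u, opU_comm]
  | s_u p p' q hp hq hq' =>
    rw [map_mul, map_mul, freeAct_s, freeAct_u]
    refine opPerm_swap_mul_opU hV κ hq hq' ?_
    -- Adjacent indices lie on the same side of any third index.
    rw [Ne, Fin.ext_iff] at hq hq'
    rw [Fin.lt_def, Fin.lt_def]
    omega
  | s_u_succ p p' hp =>
    rw [map_mul, map_sub, map_mul, map_one, freeAct_s, freeAct_u, freeAct_u]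
    exact opPerm_swap_mul_opU_succ hV κ hp
  | s_x σ p =>
    rw [map_mul, map_mul, freeAct_s, freeAct_s, freeAct_x, freeAct_x, opPerm_mul_mulW, mul_assoc,
      ← opPerm_mul, mul_inv_cancel, opPerm_one, mul_one, permL_xPow]
  | z_x p q h =>
    rw [map_sub, map_mul, map_mul, map_neg, map_mul, freeAct_z, freeAct_x, freeAct_x, freeAct_s,
      opCherednik_mul_xPow_of_ne hV κ h]
    exact (sub_right_comm _ _ _).trans (by rw [sub_self, zero_sub])
  | z_x_same p =>
    rw [map_sub, map_mul, map_mul, map_add, map_smul, map_sum, freeAct_z, freeAct_x,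
      opCherednik_mul_xPow_same]
    simp only [map_mul, freeAct_x, freeAct_s]
    rw [add_assoc]
    exact add_sub_cancel_left _ _

variable (N) in
/-- The action of the trigonometric Cherednik algebra on `W`. -/
def trigAct : TrigCherednik κ N →ₐ[ℂ] Module.End ℂ (WSpace m N V) :=
  RingQuot.liftAlgHom ℂ ⟨freeAct N hV κ, fun _ _ h => freeAct_rel hV κ h⟩

theorem trigAct_toTrig (a : FreeGen N) : trigAct N hV κ (toTrig κ N a) = freeAct N hV κ a :=
  RingQuot.liftAlgHom_mkAlgHom_apply _ _ _ _

theorem isCherednikAction_trigAct : IsCherednikAction hV κ (trigAct N hV κ) where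
  map_x p := by rw [trigAct_toTrig, freeAct_x]; rfl
  map_xinv p := by rw [trigAct_toTrig, freeAct_xinv]; rfl
  map_s σ := by rw [trigAct_toTrig, freeAct_s]
  map_z p := by rw [trigAct_toTrig, freeAct_z]

end Action

/-- An induction principle for the trigonometric Cherednik algebra, with the generators
`x_p^±1`, `σ` and `z_p`. -/
theorem trig_induction {N : ℕ} {κ : ℂ} {C : TrigCherednik κ N → Prop}
    (algebraMap : ∀ c, C (algebraMap ℂ _ c)) (add : ∀ a b, C a → C b → C (a + b))
    (mul : ∀ a b, C a → C b → C (a * b)) (x : ∀ p, C (toTrig κ N (FreeGen.x p)))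
    (xinv : ∀ p, C (toTrig κ N (FreeGen.xinv p))) (s : ∀ σ, C (toTrig κ N (FreeGen.s σ)))
    (z : ∀ p, C (toTrig κ N (FreeGen.z p))) (h : TrigCherednik κ N) : C h := by
  obtain ⟨a, rfl⟩ := RingQuot.mkAlgHom_surjective ℂ (Rel κ N) h
  induction a using FreeAlgebra.induction with
  | grade0 r => rw [AlgHom.commutes]; exact algebraMap r
  | mul a b ha hb => rw [map_mul]; exact mul _ _ ha hb
  | add a b ha hb => rw [map_add]; exact add _ _ ha hb
  | grade1 g =>
    cases g with
    | x p => exact x p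
    | xinv p => exact xinv p
    | s σ => exact s σ
    | u p =>
      -- The generator u_p is recovered from z_p and transpositions.
      have e : FreeAlgebra.ι ℂ (Gen.u p) =
          FreeGen.z p + ∑ r ∈ Finset.Iio p, FreeGen.s (Equiv.swap r p) :=
        (sub_add_cancel _ _).symm
      rw [e, map_add, map_sum]
      refine add _ _ (z p) (Finset.sum_induction _ C add ?_ fun r _ => s _)
      have h0 := algebraMap 0
      rwa [map_zero] at h0

/-! ### Uniqueness, commutation with sl_m and stability of q W. -/

namespace IsCherednikAction

variable {m N : ℕ} {V : Type*} [AddCommGroup V] [Module ℂ V] [LieRingModule (slHat m) V]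
  [LieModule ℂ (slHat m) V] {hV : IsSmooth m V} {κ : ℂ}
  {ρ : TrigCherednik κ N →ₐ[ℂ] Module.End ℂ (WSpace m N V)}

theorem ext {ρ' : TrigCherednik κ N →ₐ[ℂ] Module.End ℂ (WSpace m N V)}
    (hρ : IsCherednikAction hV κ ρ) (hρ' : IsCherednikAction hV κ ρ') : ρ = ρ' := by
  refine AlgHom.ext fun h => ?_
  induction h using trig_induction with
  | algebraMap c => rw [AlgHom.commutes, AlgHom.commutes]
  | add a b ha hb => rw [map_add, map_add, ha, hb]
  | mul a b ha hb => rw [map_mul, map_mul, ha, hb]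
  | x p => rw [hρ.map_x, hρ'.map_x]
  | xinv p => rw [hρ.map_xinv, hρ'.map_xinv]
  | s σ => rw [hρ.map_s, hρ'.map_s]
  | z p => rw [hρ.map_z, hρ'.map_z]

theorem commute_slAct (hρ : IsCherednikAction hV κ ρ) (h : TrigCherednik κ N) (A : sl m) :
    Commute (ρ h) (slAct m N V (slT m 0 A)) := by
  induction h using trig_induction with
  | algebraMap c => rw [AlgHom.commutes]; exact Algebra.commutes c _
  | add a b ha hb => rw [map_add]; exact ha.add_left hb
  | mul a b ha hb => rw [map_mul]; exact ha.mul_left hb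
  | x p => rw [hρ.map_x]; exact mulW_mul_slAct _ _ _
  | xinv p => rw [hρ.map_xinv]; exact mulW_mul_slAct _ _ _
  | s σ => rw [hρ.map_s]; exact opPerm_mul_slAct _ _ _
  | z p => rw [hρ.map_z]; exact opCherednik_mul_slAct_zero hV κ p A

theorem map_mem_qW (hρ : IsCherednikAction hV κ ρ) (hℓ : HasLevel m V (κ - m))
    (h : TrigCherednik κ N) : ∀ w ∈ qW m N V, ρ h w ∈ qW m N V := by
  -- The generators other than z_p commute with all currents, so only z_p requires the level.
  have aux : ∀ F : Module.End ℂ (WSpace m N V),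
      (∀ (j : ℤ) (A : sl m), F * slAct m N V (slT m j A) = slAct m N V (slT m j A) * F) →
      ∀ w ∈ qW m N V, F w ∈ qW m N V := by
    intro F hF w hw
    refine map_qW_le (fun j A w hj => ?_) hw
    rw [← Module.End.mul_apply, hF]
    exact slAct_mem_qW (by omega) A _
  induction h using trig_induction with
  | algebraMap c =>
    intro w hw
    rw [AlgHom.commutes]
    exact Submodule.smul_mem _ c hw
  | add a b ha hb =>
    intro w hw
    rw [map_add]
    exact add_mem (ha w hw) (hb w hw)
  | mul a b ha hb =>
    intro w hw
    rw [map_mul]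
    exact ha _ (hb w hw)
  | x p => rw [hρ.map_x]; exact aux _ fun j A => mulW_mul_slAct _ _ _
  | xinv p => rw [hρ.map_xinv]; exact aux _ fun j A => mulW_mul_slAct _ _ _
  | s σ => rw [hρ.map_s]; exact aux _ fun j A => opPerm_mul_slAct _ _ _
  | z p => rw [hρ.map_z]; exact fun w hw => opCherednik_mem_qW hV κ hℓ p hw

end IsCherednikAction

/-! ### Functoriality -/

section Functoriality

variable {m N : ℕ} {V V' : Type*} [AddCommGroup V] [Module ℂ V] [AddCommGroup V'] [Module ℂ V']

theorem map_id_map_left (f : V →ₗ[ℂ] V') (a : Module.End ℂ (Laurent N ⊗[ℂ] Tens m N))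
    (w : WSpace m N V) :
    TensorProduct.map LinearMap.id f (TensorProduct.map a LinearMap.id w) =
      TensorProduct.map a LinearMap.id (TensorProduct.map LinearMap.id f w) := by
  induction w using TensorProduct.induction_on with
  | zero => simp only [map_zero]
  | add x y hx hy => simp only [map_add, hx, hy]
  | tmul t v => rfl

variable [LieRingModule (slHat m) V] [LieModule ℂ (slHat m) V] [LieRingModule (slHat m) V']
  [LieModule ℂ (slHat m) V']

theorem map_id_map_toEnd (f : V →ₗ⁅ℂ, slHat m⁆ V') (a : Module.End ℂ (Laurent N ⊗[ℂ] Tens m N))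
    (X : slHat m) (w : WSpace m N V) :
    TensorProduct.map LinearMap.id (f : V →ₗ[ℂ] V')
        (TensorProduct.map a (LieModule.toEnd ℂ (slHat m) V X) w) =
      TensorProduct.map a (LieModule.toEnd ℂ (slHat m) V' X)
        (TensorProduct.map LinearMap.id (f : V →ₗ[ℂ] V') w) := by
  induction w using TensorProduct.induction_on with
  | zero => simp only [map_zero]
  | add x y hx hy => simp only [map_add, hx, hy]
  | tmul t v =>
    simp only [TensorProduct.map_tmul, LieModule.toEnd_apply_apply, LinearMap.id_apply]
    exact congrArg _ (f.map_lie X v)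

theorem map_id_slAct (f : V →ₗ⁅ℂ, slHat m⁆ V') (X : slHat m) (w : WSpace m N V) :
    TensorProduct.map LinearMap.id (f : V →ₗ[ℂ] V') (slAct m N V X w) =
      slAct m N V' X (TensorProduct.map LinearMap.id (f : V →ₗ[ℂ] V') w) := by
  change TensorProduct.map LinearMap.id (f : V →ₗ[ℂ] V')
    (TensorProduct.map (currentAct m N (toCurrent m X)) LinearMap.id w +
      TensorProduct.map LinearMap.id (LieModule.toEnd ℂ (slHat m) V X) w) = _
  rw [map_add, map_id_map_left, map_id_map_toEnd]
  rfl

theorem map_id_opCherednik (hV : IsSmooth m V) (hV' : IsSmooth m V') (κ : ℂ)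
    (f : V →ₗ⁅ℂ, slHat m⁆ V') (p : Fin N) (w : WSpace m N V) :
    TensorProduct.map LinearMap.id (f : V →ₗ[ℂ] V') (opCherednik N hV κ p w) =
      opCherednik N hV' κ p (TensorProduct.map LinearMap.id (f : V →ₗ[ℂ] V') w) := by
  rw [opCherednik, opCherednik, LinearMap.add_apply, LinearMap.add_apply, map_add]
  congr 1
  · simp only [opDunkl, LinearMap.add_apply, LinearMap.smul_apply, LinearMap.sum_apply, map_add,
      map_smul, map_sum, map_id_map_left]
  · refine map_opGap hV hV' p p _ (fun i w => ?_) w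
    simp only [opGapTerm, LinearMap.sum_apply, map_sum, map_id_map_toEnd]

theorem IsCherednikAction.map_id_apply {hV : IsSmooth m V} {hV' : IsSmooth m V'} {κ : ℂ}
    {ρ : TrigCherednik κ N →ₐ[ℂ] Module.End ℂ (WSpace m N V)}
    {ρ' : TrigCherednik κ N →ₐ[ℂ] Module.End ℂ (WSpace m N V')}
    (hρ : IsCherednikAction hV κ ρ) (hρ' : IsCherednikAction hV' κ ρ')
    (f : V →ₗ⁅ℂ, slHat m⁆ V') (h : TrigCherednik κ N) : ∀ w : WSpace m N V,
    TensorProduct.map LinearMap.id (f : V →ₗ[ℂ] V') (ρ h w) =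
      ρ' h (TensorProduct.map LinearMap.id (f : V →ₗ[ℂ] V') w) := by
  induction h using trig_induction with
  | algebraMap c =>
    intro w
    rw [AlgHom.commutes, AlgHom.commutes]
    exact map_smul _ c w
  | add a b ha hb =>
    intro w
    rw [map_add, map_add, LinearMap.add_apply, LinearMap.add_apply, map_add, ha, hb]
  | mul a b ha hb =>
    intro w
    rw [map_mul, map_mul, Module.End.mul_apply, Module.End.mul_apply, ha, hb]
  | x p => rw [hρ.map_x, hρ'.map_x]; exact map_id_map_left _ _
  | xinv p => rw [hρ.map_xinv, hρ'.map_xinv]; exact map_id_map_left _ _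
  | s σ => rw [hρ.map_s, hρ'.map_s]; exact map_id_map_left _ _
  | z p => rw [hρ.map_z, hρ'.map_z]; exact map_id_opCherednik hV hV' κ f p

end Functoriality

end AffineCherednik

end

/-! ### The theorem. -/

open AffineCherednik in
theorem corollary1p6 (m N : ℕ) (hm : 0 < m) (hN : 0 < N) (κ : ℂ)
    (V : Type*) [AddCommGroup V] [Module ℂ V] [LieRingModule (slHat m) V]
    [LieModule ℂ (slHat m) V] (hV : IsSmooth m V) :
    (∃! ρ : TrigCherednik κ N →ₐ[ℂ] Module.End ℂ (WSpace m N V), IsCherednikAction hV κ ρ) ∧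
    ∀ ρ : TrigCherednik κ N →ₐ[ℂ] Module.End ℂ (WSpace m N V), IsCherednikAction hV κ ρ →
      (∀ (h : TrigCherednik κ N) (A : sl m), Commute (ρ h) (slAct m N V (slT m 0 A))) ∧
      (HasLevel m V (κ - m) → ∀ h : TrigCherednik κ N, ∀ w ∈ qW m N V, ρ h w ∈ qW m N V) ∧
      (∀ (V' : Type*) [AddCommGroup V'] [Module ℂ V'] [LieRingModule (slHat m) V']
        [LieModule ℂ (slHat m) V'] (hV' : IsSmooth m V')
        (ρ' : TrigCherednik κ N →ₐ[ℂ] Module.End ℂ (WSpace m N V')),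
        IsCherednikAction hV' κ ρ' → ∀ f : V →ₗ⁅ℂ, slHat m⁆ V',
          (∀ (h : TrigCherednik κ N) (w : WSpace m N V),
            TensorProduct.map LinearMap.id (f : V →ₗ[ℂ] V') (ρ h w) =
              ρ' h (TensorProduct.map LinearMap.id (f : V →ₗ[ℂ] V') w)) ∧
          (∀ (X : slHat m) (w : WSpace m N V),
            TensorProduct.map LinearMap.id (f : V →ₗ[ℂ] V') (slAct m N V X w) =
              slAct m N V' X (TensorProduct.map LinearMap.id (f : V →ₗ[ℂ] V') w))) := by
  refine ⟨⟨trigAct N hV κ, isCherednikAction_trigAct hV κ, fun ρ hρ =>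
    hρ.ext (isCherednikAction_trigAct hV κ)⟩, fun ρ hρ => ⟨hρ.commute_slAct, hρ.map_mem_qW, ?_⟩⟩
  intro V' _ _ _ _ hV' ρ' hρ' f
  exact ⟨hρ.map_id_apply hρ' f, map_id_slAct f⟩
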